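/- Let $\mathbf{Diff}$ be the category of smooth finite-dimensional manifolds (Hausdorff, second countable, without boundary, each of some fixed dimension) and smooth maps, and let $\mathrm{Subm}$ be the class of surjective submersions in $\mathbf{Diff}$. A Lie category $X$ is a category internal to $\mathbf{Diff}$, with manifolds $X_0$ of objects and $X_1$ of arrows, whose source and target maps $s,t\colon X_1\to X_0$ are submersions. Let $f=(f_0,f_1)\colon X\to Y$ be an internal functor between Lie categories. All pullbacks below are taken in $\mathbf{Diff}$. (a) $f$ is *fully faithful* if the square with sides $f_1\colon X_1\to Y_1$, $(s,t)\colon X_1\to X_0\times X_0$, $(s,t)\colon Y_1\to Y_0\times Y_0$ and $f_0\times f_0\colon X_0\times X_0\to Y_0\times Y_0$ is a pullback. (b) $f$ is *$\mathrm{Subm}$-locally split* if there are a surjective submersion $j\colon U\to Y_0$ from a manifold $U$ and an internal functor $\bar f\colon Y[U]\to X$ such that $f\circ\bar f$ is naturally isomorphic (by an internal natural isomorphism) to the canonical functor $Y[U]\to Y$. Here $Y[U]$ is the base change of $Y$ along $j$: the internal category with manifold of objects $U$ and manifold of arrows the pullback of $j\times j\colon U\times U\to Y_0\times Y_0$ and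 $(s,t)\colon Y_1\to Y_0\times Y_0$, and with units and composition inherited from $Y$. (c) $f$ is *essentially $\mathrm{Subm}$-surjective* if the object $Y_1^{\mathrm{iso}}\to Y_1$ of invertible arrows of $Y$ and the pullback $X_0\times_{Y_0}Y_1^{\mathrm{iso}}$ of $f_0$ and $s\colon Y_1^{\mathrm{iso}}\to Y_0$ exist in $\mathbf{Diff}$, and the composite $X_0\times_{Y_0}Y_1^{\mathrm{iso}}\to Y_1^{\mathrm{iso}}\xrightarrow{\,t\,}Y_0$ is a surjective submersion. Here the object of invertible arrows is the manifold $Y_1^{\mathrm{iso}}$ equipped with the universal pair of mutually inverse arrows of $Y$. Call $f$ a *$\mathrm{Subm}$-equivalence* if it is fully faithful and $\mathrm{Subm}$-locally split, and a *Bunge–Paré $\mathrm{Subm}$-equivalence* if it is fully faithful and essentially $\mathrm{Subm}$-surjective. **Proposition.** An internal functor $f\colon X\to Y$ between Lie categories is a $\mathrm{Subm}$-equivalence if and only if it is a Bunge–Paré $\mathrm{Subm}$-equivalence. -/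

import Mathlib

open CategoryTheory CategoryTheory.Limits
open scoped Manifold ContDiff

universe v u

-- Arrows `A ⟶ B` are to be read through the category structure itself.
attribute [-instance] catToReflQuiver

/-! ## Categories internal to a category `S` -/

/-- The underlying diagram of an internal category in `S`: objects of objects and of arrows, source,
target, unit, and multiplication, together with the objects of composable pairs and of composable
triples (these limits are required to exist). A composable pair `(g, h)` satisfies
`tgt g = src h`, and `mul (g, h)` is "first `g`, then `h`". A composable triple is a pair of
composable pairs `((g, h), (h, k))`. -/
structure InternalCategoryData (S : Type u) [Category.{v} S] where
  obj : S
  arr : S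
  src : arr ⟶ obj
  tgt : arr ⟶ obj
  unit : obj ⟶ arr
  pairs : S
  fst : pairs ⟶ arr
  snd : pairs ⟶ arr
  isPullback_pairs : IsPullback fst snd tgt src
  triples : S
  left : triples ⟶ pairs
  right : triples ⟶ pairs
  isPullback_triples : IsPullback left right snd fst
  mul : pairs ⟶ arr

namespace InternalCategoryData

variable {S : Type u} [Category.{v} S] (X : InternalCategoryData S)

/-- The composite "first `g`, then `h`" of two composable generalised arrows of `X`, that is
`T ⟶ X₁ ×_{X₀} X₁ ⟶ X₁`. -/
noncomputable def comp {T : S} (g h : T ⟶ X.arr) (w : g ≫ X.tgt = h ≫ X.src) : T ⟶ X.arr :=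
  X.isPullback_pairs.lift g h w ≫ X.mul

end InternalCategoryData

/-- An internal category in `S`. -/
structure InternalCategory (S : Type u) [Category.{v} S] extends InternalCategoryData S where
  unit_src : unit ≫ src = 𝟙 obj
  unit_tgt : unit ≫ tgt = 𝟙 obj
  mul_src : mul ≫ src = fst ≫ src
  mul_tgt : mul ≫ tgt = snd ≫ tgt
  /-- `X₁ ⟶ X₁ ×_{X₀} X₁ ⟶ X₁`, `g ↦ 1_{src g} g`, is the identity. -/
  unit_mul : toInternalCategoryData.comp (src ≫ unit) (𝟙 arr)
    (by rw [Category.assoc, unit_tgt, Category.comp_id, Category.id_comp]) = 𝟙 arr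
  /-- `X₁ ⟶ X₁ ×_{X₀} X₁ ⟶ X₁`, `g ↦ g 1_{tgt g}`, is the identity. -/
  mul_unit : toInternalCategoryData.comp (𝟙 arr) (tgt ≫ unit)
    (by rw [Category.assoc, unit_src, Category.comp_id, Category.id_comp]) = 𝟙 arr
  /-- The two maps `X₁ ×_{X₀} X₁ ×_{X₀} X₁ ⟶ X₁`, `(g, h, k) ↦ (g h) k` and
  `(g, h, k) ↦ g (h k)`, coincide. -/
  mul_assoc : toInternalCategoryData.comp (left ≫ mul) (right ≫ snd)
      (by rw [Category.assoc, mul_tgt, ← Category.assoc, isPullback_triples.w, Category.assoc,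
        Category.assoc, isPullback_pairs.w]) =
    toInternalCategoryData.comp (left ≫ fst) (right ≫ mul)
      (by rw [Category.assoc, Category.assoc, mul_src, ← Category.assoc right,
        ← isPullback_triples.w, isPullback_pairs.w, Category.assoc])

section Functors

variable {S : Type u} [Category.{v} S]

/-- An internal functor: a pair of maps commuting with all structure maps. -/
structure InternalFunctor (X Y : InternalCategory S) where
  obj : X.obj ⟶ Y.obj
  arr : X.arr ⟶ Y.arr
  arr_src : arr ≫ Y.src = X.src ≫ obj
  arr_tgt : arr ≫ Y.tgt = X.tgt ≫ obj
  unit_arr : X.unit ≫ arr = obj ≫ Y.unit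
  mul_arr : X.mul ≫ arr = Y.comp (X.fst ≫ arr) (X.snd ≫ arr)
    (by rw [Category.assoc, Category.assoc, arr_tgt, arr_src, ← Category.assoc, ← Category.assoc,
      X.isPullback_pairs.w])

namespace InternalFunctor

variable {X Y Z : InternalCategory S}

/-- An internal functor preserves composites of generalised arrows. -/
theorem comp_arr (f : InternalFunctor X Y) {T : S} (g h : T ⟶ X.arr)
    (w : g ≫ X.tgt = h ≫ X.src) :
    X.comp g h w ≫ f.arr = Y.comp (g ≫ f.arr) (h ≫ f.arr)
      (by rw [Category.assoc, Category.assoc, f.arr_tgt, f.arr_src, ← Category.assoc,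
        ← Category.assoc, w]) := by
  simp only [InternalCategoryData.comp, Category.assoc, f.mul_arr]
  rw [← Category.assoc]
  congr 1
  apply Y.isPullback_pairs.hom_ext <;> simp

/-- The composite functor "first `f`, then `g`". -/
def comp (f : InternalFunctor X Y) (g : InternalFunctor Y Z) : InternalFunctor X Z where
  obj := f.obj ≫ g.obj
  arr := f.arr ≫ g.arr
  arr_src := by rw [Category.assoc, g.arr_src, ← Category.assoc, f.arr_src, Category.assoc]
  arr_tgt := by rw [Category.assoc, g.arr_tgt, ← Category.assoc, f.arr_tgt, Category.assoc]
  unit_arr := by rw [← Category.assoc, f.unit_arr, Category.assoc, g.unit_arr, Category.assoc]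
  mul_arr := by
    rw [← Category.assoc, f.mul_arr, g.comp_arr]
    simp only [Category.assoc]

end InternalFunctor

/-- An internal natural transformation `f ⇒ g`: a map `app : X₀ ⟶ Y₁` from `f₀` to `g₀` such that
`app (src x)` followed by `g₁ x` is `f₁ x` followed by `app (tgt x)`. -/
structure InternalNatTrans {X Y : InternalCategory S} (f g : InternalFunctor X Y) where
  app : X.obj ⟶ Y.arr
  app_src : app ≫ Y.src = f.obj
  app_tgt : app ≫ Y.tgt = g.obj
  naturality : Y.comp (X.src ≫ app) g.arr (by rw [Category.assoc, app_tgt, g.arr_src]) =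
    Y.comp f.arr (X.tgt ≫ app) (by rw [Category.assoc, app_src, f.arr_tgt])

/-- An internal natural isomorphism `f ≅ g`: natural transformations in both directions that are
inverse to each other for vertical composition, so that both vertical composites have the component
of an identity transformation. -/
structure InternalNatIso {X Y : InternalCategory S} (f g : InternalFunctor X Y) where
  hom : InternalNatTrans f g
  inv : InternalNatTrans g f
  hom_inv : Y.comp hom.app inv.app (by rw [hom.app_tgt, inv.app_src]) = f.obj ≫ Y.unit
  inv_hom : Y.comp inv.app hom.app (by rw [inv.app_tgt, hom.app_src]) = g.obj ≫ Y.unit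

namespace InternalCategory

/-- The generalised arrows `g` and `h` of `X` are mutually inverse. -/
def AreInverse (X : InternalCategory S) {T : S} (g h : T ⟶ X.arr) : Prop :=
  ∃ (w : g ≫ X.tgt = h ≫ X.src) (w' : h ≫ X.tgt = g ≫ X.src),
    X.comp g h w = g ≫ X.src ≫ X.unit ∧ X.comp h g w' = h ≫ X.src ≫ X.unit

/-- `i : I ⟶ X₁` is the object `X₁^iso ⟶ X₁` of invertible arrows of `X`, with inversion map
`inv : I ⟶ X₁`: the finite limit of all pairs of mutually inverse arrows. (For the category of
manifolds and `X` with submersive source and target, it is the open submanifold of invertible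
arrows.) -/
structure IsObjectOfIsos (X : InternalCategory S) {I : S} (i inv : I ⟶ X.arr) : Prop where
  areInverse : X.AreInverse i inv
  existsUnique : ∀ {T : S} (g h : T ⟶ X.arr), X.AreInverse g h →
    ∃! k : T ⟶ I, k ≫ i = g ∧ k ≫ inv = h

end InternalCategory

namespace InternalFunctor

variable {X Y : InternalCategory S}

/-- `f` is fully faithful: the square with sides `f₁`, `(src, tgt)`, `f₀ × f₀`, `(src, tgt)` is a
pullback. -/
def FullyFaithful [HasBinaryProducts S] (f : InternalFunctor X Y) : Prop :=
  IsPullback f.arr (prod.lift X.src X.tgt) (prod.lift Y.src Y.tgt) (prod.map f.obj f.obj)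

/-- The functor `u : B ⥤ Y` exhibits `B` as the base change `Y[U]` of `Y` along the map
`u₀ : U = B₀ ⟶ Y₀`: the object of arrows of `B` is the pullback `U² ×_{Y₀²} Y₁`, with `(src, tgt)`
and `u₁` as its projections. (The units and the multiplication of `B` are then determined by
functoriality of `u`.) -/
def IsBaseChange [HasBinaryProducts S] {B : InternalCategory S} (u : InternalFunctor B Y) : Prop :=
  IsPullback (prod.lift B.src B.tgt) u.arr (prod.map u.obj u.obj) (prod.lift Y.src Y.tgt)

/-- `f : X ⥤ Y` is `J`-locally split: there are a `J`-cover `U ⟶ Y₀`, with base change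
`u : Y[U] ⥤ Y`, and a functor `f' : Y[U] ⥤ X` such that `u` is naturally isomorphic to `f'`
followed by `f`. -/
def LocallySplit [HasBinaryProducts S] (J : MorphismProperty S) (f : InternalFunctor X Y) : Prop :=
  ∃ (B : InternalCategory S) (u : InternalFunctor B Y), u.IsBaseChange ∧ J u.obj ∧
    ∃ f' : InternalFunctor B X, Nonempty (InternalNatIso u (f'.comp f))

/-- `f` is a `J`-equivalence: it is fully faithful and `J`-locally split. -/
def IsEquivalence [HasBinaryProducts S] (J : MorphismProperty S) (f : InternalFunctor X Y) : Prop :=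
  f.FullyFaithful ∧ f.LocallySplit J

/-- `f` is essentially `J`-surjective: the object `Y₁^iso` of invertible arrows of `Y` and the
pullback `X₀ ×_{Y₀} Y₁^iso` of `f₀` along the source map exist, and the map
`X₀ ×_{Y₀} Y₁^iso ⟶ Y₁^iso ⟶ Y₀` induced by the target map is in `J`. -/
def EssentiallySurjective (J : MorphismProperty S) (f : InternalFunctor X Y) : Prop :=
  ∃ (I : S) (i inv : I ⟶ Y.arr) (P : S) (p : P ⟶ X.obj) (q : P ⟶ I),
    Y.IsObjectOfIsos i inv ∧ IsPullback p q f.obj (i ≫ Y.src) ∧ J (q ≫ i ≫ Y.tgt)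

/-- `f` is a Bunge–Paré `J`-equivalence: it is fully faithful and essentially `J`-surjective. -/
def IsBungePareEquivalence [HasBinaryProducts S] (J : MorphismProperty S)
    (f : InternalFunctor X Y) : Prop :=
  f.FullyFaithful ∧ f.EssentiallySurjective J

end InternalFunctor

end Functors

/-! ## Smooth manifolds -/

/-- A smooth finite-dimensional manifold (without boundary, Hausdorff and second countable), modelled
on the finite-dimensional real vector space `E`. -/
structure Diff : Type (u + 1) where
  carrier : Type u
  E : Type
  [normedAddCommGroup : NormedAddCommGroup E]
  [normedSpace : NormedSpace ℝ E]
  [finiteDimensional : FiniteDimensional ℝ E]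
  [topologicalSpace : TopologicalSpace carrier]
  [chartedSpace : ChartedSpace E carrier]
  [isManifold : IsManifold 𝓘(ℝ, E) ∞ carrier]
  [t2Space : T2Space carrier]
  [secondCountableTopology : SecondCountableTopology carrier]

namespace Diff

attribute [instance] normedAddCommGroup normedSpace finiteDimensional topologicalSpace chartedSpace
  isManifold t2Space secondCountableTopology

/-- A smooth map. -/
@[ext]
structure Hom (M N : Diff.{u}) where
  toFun : M.carrier → N.carrier
  contMDiff : ContMDiff 𝓘(ℝ, M.E) 𝓘(ℝ, N.E) ∞ toFun

/-- The category of smooth manifolds and smooth maps. -/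
instance : Category.{u} Diff.{u} where
  Hom M N := Hom M N
  id M := ⟨id, contMDiff_id⟩
  comp f g := ⟨g.toFun ∘ f.toFun, g.contMDiff.comp f.contMDiff⟩

/-- The product manifold. -/
noncomputable def prodObj (M N : Diff.{u}) : Diff.{u} where
  carrier := M.carrier × N.carrier
  E := M.E × N.E
  chartedSpace := prodChartedSpace M.E M.carrier N.E N.carrier
  isManifold := by
    rw [modelWithCornersSelf_prod]
    exact IsManifold.prod M.carrier N.carrier

/-- The first projection of the product manifold. -/
noncomputable def prodFst (M N : Diff.{u}) : prodObj M N ⟶ M where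
  toFun := Prod.fst
  contMDiff := by
    have h : ContMDiff (𝓘(ℝ, M.E).prod 𝓘(ℝ, N.E)) 𝓘(ℝ, M.E) ∞
      (Prod.fst : M.carrier × N.carrier → M.carrier) := contMDiff_fst
    rw [← modelWithCornersSelf_prod] at h
    exact h

/-- The second projection of the product manifold. -/
noncomputable def prodSnd (M N : Diff.{u}) : prodObj M N ⟶ N where
  toFun := Prod.snd
  contMDiff := by
    have h : ContMDiff (𝓘(ℝ, M.E).prod 𝓘(ℝ, N.E)) 𝓘(ℝ, N.E) ∞
      (Prod.snd : M.carrier × N.carrier → N.carrier) := contMDiff_snd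
    rw [← modelWithCornersSelf_prod] at h
    exact h

/-- The map to the product manifold with given components. -/
noncomputable def prodLift {T M N : Diff.{u}} (f : T ⟶ M) (g : T ⟶ N) : T ⟶ prodObj M N where
  toFun := fun x ↦ (Hom.toFun f x, Hom.toFun g x)
  contMDiff := by
    have h := (Hom.contMDiff f).prodMk (Hom.contMDiff g)
    rw [← modelWithCornersSelf_prod] at h
    exact h

/-- The category of smooth manifolds has binary products, given by the product manifolds. -/
instance : HasBinaryProducts Diff.{u} := by
  have (M N : Diff.{u}) : HasLimit (pair M N) :=
    ⟨⟨⟨BinaryFan.mk (prodFst M N) (prodSnd M N),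
      BinaryFan.isLimitMk (fun s ↦ prodLift s.fst s.snd) (fun _ ↦ rfl) (fun _ ↦ rfl)
        (fun s m h₁ h₂ ↦ by
          apply Hom.ext
          funext x
          exact Prod.ext (congrFun (congrArg Hom.toFun h₁) x)
            (congrFun (congrArg Hom.toFun h₂) x))⟩⟩⟩
  exact hasBinaryProducts_of_hasLimit_pair _

/-- The smooth map `f` is a submersion. -/
def IsSubmersion {M N : Diff.{u}} (f : M ⟶ N) : Prop :=
  Manifold.IsSubmersion 𝓘(ℝ, M.E) 𝓘(ℝ, N.E) ∞ (Hom.toFun f)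

/-- The class of surjective submersions. -/
def Subm : MorphismProperty Diff.{u} :=
  fun _ _ f ↦ IsSubmersion f ∧ Function.Surjective (Hom.toFun f)

end Diff

/-- A Lie category: a category internal to smooth manifolds whose source and target maps are
submersions. -/
structure LieCategory : Type (u + 1) extends InternalCategory Diff.{u} where
  src_isSubmersion : Diff.IsSubmersion src
  tgt_isSubmersion : Diff.IsSubmersion tgt

/-! Full faithfulness is common to both notions, so for a fully faithful `f` local splitness has to
be compared with essential surjectivity. Write P = X₀ ×_{Y₀} Y₁^iso; its points are objects x of X
with an isomorphism from f x to an object y of Y, and it maps to Y₀ by y.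

If P ⟶ Y₀ is a surjective submersion, P itself serves as the cover. It carries a tautological family
of isomorphisms f x ≅ y; conjugating Y[P] ⥤ Y by this family and lifting through the fully faithful
`f` gives a functor Y[P] ⥤ X (`exists_factorization`). The manifolds that make up Y[P] exist because
submersions can be pulled back (`exists_isPullback`).

Conversely, let u : Y[U] ⥤ Y be isomorphic to f' followed by f. The pullback W of the target map
X₁^iso ⟶ X₀ along f'₀ is a surjective submersion over U, hence over Y₀. Applying f and composing
with the given isomorphism defines a map κ : W ⟶ P over Y₀ (`exists_comparison`). It is onto,
because each y lifts to U and isomorphisms f x ≅ f x' lift to X. By the chain rule P ⟶ Y₀ is then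
submersive at every κ w, that is, everywhere.

The analytic input is that Y₁^iso exists, as an open submanifold of Y₁. Measured by coordinates
along the source fibres, g h = 1 is a submersive equation near a pair of inverse arrows, so its
solutions form a manifold with a submersion to the arrows g (`exists_right_inverse`). The opposite
category gives left inverses, and the two inverses agree. -/

section InternalCategories

variable {S : Type u} [Category.{v} S]

/-! ### Calculus of generalised arrows -/

namespace InternalCategoryData

/-- The composability proof mentions both factors, so a factor cannot be rewritten in place; this
lemma carries the proof along. -/
theorem comp_congr (X : InternalCategoryData S) {T : S} {g g' h h' : T ⟶ X.arr}
    {w : g ≫ X.tgt = h ≫ X.src} (hg : g = g') (hh : h = h') :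
    X.comp g h w = X.comp g' h' (by rw [← hg, ← hh, w]) := by
  subst hg hh; rfl

/-- Naturality in the test object. With it, identities for the universal pairs and triples can be
used on arbitrary generalised arrows. -/
theorem precomp_comp (X : InternalCategoryData S) {T T' : S} (k : T' ⟶ T) (g h : T ⟶ X.arr)
    (w : g ≫ X.tgt = h ≫ X.src) :
    k ≫ X.comp g h w = X.comp (k ≫ g) (k ≫ h) (by simp only [Category.assoc, w]) := by
  simp only [comp, ← Category.assoc]
  congr 1
  apply X.isPullback_pairs.hom_ext <;> simp

end InternalCategoryData

namespace InternalCategory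

variable (X : InternalCategory S) {T : S}

@[simp]
theorem comp_src (g h : T ⟶ X.arr) (w : g ≫ X.tgt = h ≫ X.src) :
    X.comp g h w ≫ X.src = g ≫ X.src := by
  simp [InternalCategoryData.comp, X.mul_src]

@[simp]
theorem comp_tgt (g h : T ⟶ X.arr) (w : g ≫ X.tgt = h ≫ X.src) :
    X.comp g h w ≫ X.tgt = h ≫ X.tgt := by
  simp [InternalCategoryData.comp, X.mul_tgt]

theorem unit_comp (x : T ⟶ X.obj) (g : T ⟶ X.arr) (hx : x = g ≫ X.src) :
    X.comp (x ≫ X.unit) g (by simp [X.unit_tgt, hx]) = g := by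
  subst hx
  have := congrArg (fun k ↦ g ≫ k) X.unit_mul
  simp only [InternalCategoryData.precomp_comp, Category.comp_id] at this
  rw [← this]
  apply InternalCategoryData.comp_congr <;> simp [this]

theorem comp_unit (g : T ⟶ X.arr) (x : T ⟶ X.obj) (hx : x = g ≫ X.tgt) :
    X.comp g (x ≫ X.unit) (by simp [X.unit_src, hx]) = g := by
  subst hx
  have := congrArg (fun k ↦ g ≫ k) X.mul_unit
  simp only [InternalCategoryData.precomp_comp, Category.comp_id] at this
  rw [← this]
  apply InternalCategoryData.comp_congr <;> simp [this]

theorem comp_assoc (g h k : T ⟶ X.arr) (w : g ≫ X.tgt = h ≫ X.src) (w' : h ≫ X.tgt = k ≫ X.src) :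
    X.comp (X.comp g h w) k (by rw [comp_tgt, w']) =
      X.comp g (X.comp h k w') (by rw [comp_src, w]) := by
  let l := X.isPullback_triples.lift (X.isPullback_pairs.lift g h w)
    (X.isPullback_pairs.lift h k w') (by simp)
  have := congrArg (fun m ↦ l ≫ m) X.mul_assoc
  simp only [InternalCategoryData.precomp_comp] at this
  convert this using 1
  · apply InternalCategoryData.comp_congr
    · simp [l, InternalCategoryData.comp]
    · simp [l]
  · apply InternalCategoryData.comp_congr
    · simp [l]
    · simp [l, InternalCategoryData.comp]

theorem AreInverse.precomp {X : InternalCategory S} {g h : T ⟶ X.arr} (H : X.AreInverse g h)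
    {T' : S} (k : T' ⟶ T) : X.AreInverse (k ≫ g) (k ≫ h) := by
  obtain ⟨w, w', e, e'⟩ := H
  refine ⟨by simp [w], by simp [w'], ?_, ?_⟩
  · rw [← InternalCategoryData.precomp_comp _ _ _ _ w, e]; simp
  · rw [← InternalCategoryData.precomp_comp _ _ _ _ w', e']; simp

theorem AreInverse.symm {X : InternalCategory S} {g h : T ⟶ X.arr} (H : X.AreInverse g h) :
    X.AreInverse h g := by
  obtain ⟨w, w', e, e'⟩ := H
  exact ⟨w', w, e', e⟩

/-- A left inverse and a right inverse of the same arrow coincide. -/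
theorem left_inv_eq_right_inv (g l r : T ⟶ X.arr) (wl : l ≫ X.tgt = g ≫ X.src)
    (wr : g ≫ X.tgt = r ≫ X.src) (hl : X.comp l g wl = g ≫ X.tgt ≫ X.unit)
    (hr : X.comp g r wr = g ≫ X.src ≫ X.unit) : l = r := by
  have h1 := X.comp_assoc l g r wl wr
  have h2 : X.comp (X.comp l g wl) r (by rw [comp_tgt, wr]) = r := by
    rw [InternalCategoryData.comp_congr _ (g' := (g ≫ X.tgt) ≫ X.unit) (h' := r) (by simp [hl]) rfl]
    exact X.unit_comp _ _ wr
  have h3 : X.comp l (X.comp g r wr) (by rw [comp_src, wl]) = l := by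
    rw [InternalCategoryData.comp_congr _ (g' := l) (h' := (g ≫ X.src) ≫ X.unit) rfl (by simp [hr])]
    exact X.comp_unit _ _ wl.symm
  rw [← h3, ← h1, h2]

theorem AreInverse.unique {X : InternalCategory S} {g h h' : T ⟶ X.arr} (H : X.AreInverse g h)
    (H' : X.AreInverse g h') : h = h' := by
  obtain ⟨w, w', e, e'⟩ := H
  obtain ⟨v, v', d, d'⟩ := H'
  refine X.left_inv_eq_right_inv g h h' w' v ?_ d
  rw [e', ← Category.assoc, ← w, Category.assoc]

theorem areInverse_of_left_of_right {X : InternalCategory S} (g l r : T ⟶ X.arr)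
    (wl : l ≫ X.tgt = g ≫ X.src)
    (wr : g ≫ X.tgt = r ≫ X.src) (hl : X.comp l g wl = g ≫ X.tgt ≫ X.unit)
    (hr : X.comp g r wr = g ≫ X.src ≫ X.unit) : X.AreInverse g r := by
  obtain rfl := X.left_inv_eq_right_inv g l r wl wr hl hr
  refine ⟨wr, wl, hr, ?_⟩
  rw [hl, ← Category.assoc, wr, Category.assoc]

theorem areInverse_unit (x : T ⟶ X.obj) : X.AreInverse (x ≫ X.unit) (x ≫ X.unit) := by
  have : X.comp (x ≫ X.unit) (x ≫ X.unit) (by simp [X.unit_src, X.unit_tgt]) = x ≫ X.unit :=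
    X.unit_comp _ _ (by simp [X.unit_src])
  refine ⟨by simp [X.unit_src, X.unit_tgt], by simp [X.unit_src, X.unit_tgt], ?_, ?_⟩ <;>
  · rw [this, Category.assoc, ← Category.assoc X.unit, X.unit_src, Category.id_comp]

theorem AreInverse.comp {X : InternalCategory S} {g g' h h' : T ⟶ X.arr} (H : X.AreInverse g g')
    (K : X.AreInverse h h') (w : g ≫ X.tgt = h ≫ X.src) :
    X.AreInverse (X.comp g h w) (X.comp h' g' (by rw [K.choose_spec.choose, ← w, H.choose])) := by
  obtain ⟨a, a', e, e'⟩ := H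
  obtain ⟨b, b', d, d'⟩ := K
  -- `key` says `(p q)(q' p') = 1`: cancel `q q'`, then `p p'`. Both required identities are
  -- instances, with the roles of the two pairs exchanged.
  have key : ∀ (p q q' p' : T ⟶ X.arr) (w1 : p ≫ X.tgt = q ≫ X.src) (w2 : q ≫ X.tgt = q' ≫ X.src)
      (w3 : q' ≫ X.tgt = p' ≫ X.src) (w4 : p ≫ X.tgt = p' ≫ X.src)
      (h1 : X.comp q q' w2 = q ≫ X.src ≫ X.unit) (h2 : X.comp p p' w4 = p ≫ X.src ≫ X.unit),
      X.comp (X.comp p q w1) (X.comp q' p' w3) (by simp [w2]) = p ≫ X.src ≫ X.unit := by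
    intro p q q' p' w1 w2 w3 w4 h1 h2
    rw [X.comp_assoc p q _ w1 (by simp [w2]), InternalCategoryData.comp_congr _ rfl
      (X.comp_assoc q q' p' w2 w3).symm, ← h2]
    refine InternalCategoryData.comp_congr _ rfl ?_
    rw [InternalCategoryData.comp_congr _ (g' := (q ≫ X.src) ≫ X.unit) (by simp [h1]) rfl]
    exact X.unit_comp _ _ (by rw [← w1, w4])
  refine ⟨by simp [b], by simp [a'], ?_, ?_⟩
  · rw [key g h h' g' w b _ a d e, ← Category.assoc (X.comp _ _ _), comp_src, Category.assoc]
  · rw [key h' g' g h (by rw [b', ← w, a]) a' _ b' e' d', ← Category.assoc (X.comp _ _ _),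
      comp_src, Category.assoc]

/-- The opposite internal category. -/
def op : InternalCategory S where
  obj := X.obj
  arr := X.arr
  src := X.tgt
  tgt := X.src
  unit := X.unit
  pairs := X.pairs
  fst := X.snd
  snd := X.fst
  isPullback_pairs := X.isPullback_pairs.flip
  triples := X.triples
  left := X.right
  right := X.left
  isPullback_triples := X.isPullback_triples.flip
  mul := X.mul
  unit_src := X.unit_tgt
  unit_tgt := X.unit_src
  mul_src := X.mul_tgt
  mul_tgt := X.mul_src
  unit_mul := by
    refine Eq.trans ?_ X.mul_unit
    simp only [InternalCategoryData.comp]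
    congr 1
    apply X.isPullback_pairs.hom_ext <;> simp
  mul_unit := by
    refine Eq.trans ?_ X.unit_mul
    simp only [InternalCategoryData.comp]
    congr 1
    apply X.isPullback_pairs.hom_ext <;> simp
  mul_assoc := by
    have := X.mul_assoc
    simp only [InternalCategoryData.comp] at this ⊢
    convert this.symm using 2 <;>
    apply X.isPullback_pairs.hom_ext <;> simp

theorem op_comp (g h : T ⟶ X.arr) (w : g ≫ X.src = h ≫ X.tgt) :
    X.op.comp g h w = X.comp h g w.symm := by
  simp only [InternalCategoryData.comp]
  change _ ≫ X.mul = _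
  congr 1
  apply X.isPullback_pairs.hom_ext
  · exact (X.op.isPullback_pairs.lift_snd g h w).trans (X.isPullback_pairs.lift_fst h g _).symm
  · exact (X.op.isPullback_pairs.lift_fst g h w).trans (X.isPullback_pairs.lift_snd h g _).symm

theorem AreInverse.op {X : InternalCategory S} {g h : T ⟶ X.arr} (H : X.AreInverse g h) :
    X.op.AreInverse g h := by
  obtain ⟨w, w', e, e'⟩ := H
  refine ⟨w'.symm, w.symm, ?_, ?_⟩
  · refine (X.op_comp g h w'.symm).trans (e'.trans ?_)
    rw [← Category.assoc, ← w, Category.assoc]; rfl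
  · refine (X.op_comp h g w.symm).trans (e.trans ?_)
    rw [← Category.assoc, ← w', Category.assoc]; rfl

end InternalCategory

end InternalCategories

theorem InternalFunctor.map_areInverse {S : Type u} [Category.{v} S]
    {X Y : InternalCategory S} (f : InternalFunctor X Y) {T : S}
    {a b : T ⟶ X.arr} (h : X.AreInverse a b) : Y.AreInverse (a ≫ f.arr) (b ≫ f.arr) := by
  obtain ⟨w, w', e, e'⟩ := h
  refine ⟨by simp [f.arr_src, f.arr_tgt, reassoc_of% w], by
    simp [f.arr_src, f.arr_tgt, reassoc_of% w'], ?_, ?_⟩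
  · rw [← f.comp_arr _ _ w, e]; simp [reassoc_of% f.arr_src, f.unit_arr]
  · rw [← f.comp_arr _ _ w', e']; simp [reassoc_of% f.arr_src, f.unit_arr]

/-! ### Fully faithful functors -/

section FullyFaithful

variable {S : Type u} [Category.{v} S] [HasBinaryProducts S] {X Y : InternalCategory S}

namespace InternalFunctor.FullyFaithful

variable {f : InternalFunctor X Y} {T : S}

theorem hom_ext (hf : f.FullyFaithful) {a b : T ⟶ X.arr} (hs : a ≫ X.src = b ≫ X.src)
    (ht : a ≫ X.tgt = b ≫ X.tgt) (h : a ≫ f.arr = b ≫ f.arr) : a = b := by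
  apply IsPullback.hom_ext hf h
  apply Limits.prod.hom_ext <;> simp [hs, ht]

theorem exists_lift (hf : f.FullyFaithful) (x x' : T ⟶ X.obj) (y : T ⟶ Y.arr)
    (hs : y ≫ Y.src = x ≫ f.obj) (ht : y ≫ Y.tgt = x' ≫ f.obj) :
    ∃ a : T ⟶ X.arr, a ≫ X.src = x ∧ a ≫ X.tgt = x' ∧ a ≫ f.arr = y := by
  have w : y ≫ prod.lift Y.src Y.tgt = prod.lift x x' ≫ prod.map f.obj f.obj := by
    apply Limits.prod.hom_ext <;> simp [hs, ht]
  obtain ⟨k, hk, hk'⟩ : ∃ k : T ⟶ X.arr, k ≫ f.arr = y ∧ k ≫ prod.lift X.src X.tgt =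
      prod.lift x x' := ⟨_, IsPullback.lift_fst hf _ _ w, IsPullback.lift_snd hf _ _ w⟩
  refine ⟨k, ?_, ?_, hk⟩
  · rw [← prod.lift_fst X.src X.tgt, ← Category.assoc, hk', prod.lift_fst]
  · rw [← prod.lift_snd X.src X.tgt, ← Category.assoc, hk', prod.lift_snd]

/-- A fully faithful functor reflects mutually inverse arrows. -/
theorem areInverse (hf : f.FullyFaithful) {a b : T ⟶ X.arr} (w : a ≫ X.tgt = b ≫ X.src)
    (w' : b ≫ X.tgt = a ≫ X.src) (h : Y.AreInverse (a ≫ f.arr) (b ≫ f.arr)) :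
    X.AreInverse a b := by
  obtain ⟨v, v', e, e'⟩ := h
  refine ⟨w, w', hf.hom_ext ?_ ?_ ?_, hf.hom_ext ?_ ?_ ?_⟩
  · simp [X.unit_src]
  · simp [X.unit_tgt, w']
  · rw [f.comp_arr, e]; simp [reassoc_of% f.arr_src, f.unit_arr]
  · simp [X.unit_src]
  · simp [X.unit_tgt, w]
  · rw [f.comp_arr, e']; simp [reassoc_of% f.arr_src, f.unit_arr]

end InternalFunctor.FullyFaithful

end FullyFaithful

/-! ### Base change of an internal category -/

section BaseChange

variable {S : Type u} [Category.{v} S] [HasBinaryProducts S] (Y : InternalCategory S)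
  {U B : S} {j : U ⟶ Y.obj} {s t : B ⟶ U} {y : B ⟶ Y.arr}

/-- `s, t : B ⟶ U` and `y : B ⟶ Y₁` exhibit `B` as the pullback `U² ×_{Y₀²} Y₁`. -/
def IsArrowPullback (j : U ⟶ Y.obj) (s t : B ⟶ U) (y : B ⟶ Y.arr) : Prop :=
  IsPullback (prod.lift s t) y (prod.map j j) (prod.lift Y.src Y.tgt)

namespace IsArrowPullback

variable {Y} (H : IsArrowPullback Y j s t y) {T : S}

include H

theorem src : y ≫ Y.src = s ≫ j := by
  have h := CommSq.w (IsPullback.toCommSq H)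
  rw [← prod.lift_fst Y.src Y.tgt, ← Category.assoc, ← h, Category.assoc, prod.map_fst,
    prod.lift_fst_assoc]

theorem tgt : y ≫ Y.tgt = t ≫ j := by
  have h := CommSq.w (IsPullback.toCommSq H)
  rw [← prod.lift_snd Y.src Y.tgt, ← Category.assoc, ← h, Category.assoc, prod.map_snd,
    prod.lift_snd_assoc]

theorem hom_ext {a b : T ⟶ B} (hs : a ≫ s = b ≫ s) (ht : a ≫ t = b ≫ t) (hy : a ≫ y = b ≫ y) :
    a = b := by
  apply IsPullback.hom_ext H _ hy
  apply Limits.prod.hom_ext <;> simp [hs, ht]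

theorem exists_lift (a b : T ⟶ U) (c : T ⟶ Y.arr) (hs : c ≫ Y.src = a ≫ j)
    (ht : c ≫ Y.tgt = b ≫ j) : ∃ k : T ⟶ B, k ≫ s = a ∧ k ≫ t = b ∧ k ≫ y = c := by
  have w : prod.lift a b ≫ prod.map j j = c ≫ prod.lift Y.src Y.tgt := by
    apply Limits.prod.hom_ext <;> simp [hs, ht]
  obtain ⟨k, hk, hk'⟩ : ∃ k : T ⟶ B, k ≫ prod.lift s t = prod.lift a b ∧ k ≫ y = c :=
    ⟨_, IsPullback.lift_fst H _ _ w, IsPullback.lift_snd H _ _ w⟩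
  refine ⟨k, ?_, ?_, hk'⟩
  · rw [← prod.lift_fst s t, ← Category.assoc, hk, prod.lift_fst]
  · rw [← prod.lift_snd s t, ← Category.assoc, hk, prod.lift_snd]

end IsArrowPullback

namespace IsArrowPullback

variable {Y} (H : IsArrowPullback Y j s t y) {P T : S} {p q : P ⟶ B} (hP : IsPullback p q t s)

include H

theorem comp_w {g h : T ⟶ B} (w : g ≫ t = h ≫ s) : (g ≫ y) ≫ Y.tgt = (h ≫ y) ≫ Y.src := by
  simp only [Category.assoc, H.src, H.tgt, reassoc_of% w]

theorem exists_unit : ∃ e : U ⟶ B, e ≫ s = 𝟙 U ∧ e ≫ t = 𝟙 U ∧ e ≫ y = j ≫ Y.unit :=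
  H.exists_lift (𝟙 U) (𝟙 U) (j ≫ Y.unit) (by simp [Y.unit_src]) (by simp [Y.unit_tgt])

include hP in
theorem exists_mul : ∃ m : P ⟶ B, m ≫ s = p ≫ s ∧ m ≫ t = q ≫ t ∧
    m ≫ y = Y.comp (p ≫ y) (q ≫ y) (H.comp_w hP.w) :=
  H.exists_lift (p ≫ s) (q ≫ t) _ (by simp [H.src]) (by simp [H.tgt])

/-- A composite in the base change is determined by its source, its target and its image in `Y`. -/
theorem lift_mul_eq {m : P ⟶ B}
    (hm : m ≫ s = p ≫ s ∧ m ≫ t = q ≫ t ∧ m ≫ y = Y.comp (p ≫ y) (q ≫ y) (H.comp_w hP.w))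
    (g h k : T ⟶ B) (w : g ≫ t = h ≫ s) (hs : g ≫ s = k ≫ s) (ht : h ≫ t = k ≫ t)
    (hy : Y.comp (g ≫ y) (h ≫ y) (H.comp_w w) = k ≫ y) : hP.lift g h w ≫ m = k := by
  apply H.hom_ext
  · rw [Category.assoc, hm.1, hP.lift_fst_assoc, hs]
  · rw [Category.assoc, hm.2.1, hP.lift_snd_assoc, ht]
  · rw [Category.assoc, hm.2.2, InternalCategoryData.precomp_comp, ← hy]
    apply InternalCategoryData.comp_congr <;> simp

end IsArrowPullback

/-- The base change of an internal category along `j : U ⟶ Y₀`, given its objects of arrows, of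
composable pairs and of composable triples. -/
noncomputable def InternalCategory.baseChange (H : IsArrowPullback Y j s t y)
    {P Q : S} {p q : P ⟶ B} {l r : Q ⟶ P}
    (hP : IsPullback p q t s) (hQ : IsPullback l r q p) {e : U ⟶ B} {m : P ⟶ B}
    (he : e ≫ s = 𝟙 U ∧ e ≫ t = 𝟙 U ∧ e ≫ y = j ≫ Y.unit)
    (hm : m ≫ s = p ≫ s ∧ m ≫ t = q ≫ t ∧ m ≫ y = Y.comp (p ≫ y) (q ≫ y) (H.comp_w hP.w)) :
    InternalCategory S where
  obj := U
  arr := B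
  src := s
  tgt := t
  unit := e
  pairs := P
  fst := p
  snd := q
  isPullback_pairs := hP
  triples := Q
  left := l
  right := r
  isPullback_triples := hQ
  mul := m
  unit_src := he.1
  unit_tgt := he.2.1
  mul_src := hm.1
  mul_tgt := hm.2.1
  unit_mul := H.lift_mul_eq hP hm _ _ _ _ (by simp [he.1]) rfl (by
    refine (InternalCategoryData.comp_congr _ (g' := (s ≫ j) ≫ Y.unit) (h' := y) ?_ ?_).trans
      ((Y.unit_comp _ _ H.src.symm).trans (Category.id_comp _).symm)
    · rw [Category.assoc, he.2.2, Category.assoc]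
    · simp)
  mul_unit := H.lift_mul_eq hP hm _ _ _ _ rfl (by simp [he.2.1]) (by
    refine (InternalCategoryData.comp_congr _ (g' := y) (h' := (t ≫ j) ≫ Y.unit) ?_ ?_).trans
      ((Y.comp_unit _ _ H.tgt.symm).trans (Category.id_comp _).symm)
    · simp
    · rw [Category.assoc, he.2.2, Category.assoc])
  mul_assoc := by
    have wl : (l ≫ p ≫ y) ≫ Y.tgt = (l ≫ q ≫ y) ≫ Y.src := by
      simpa using l ≫= H.comp_w hP.w
    have wr : (r ≫ p ≫ y) ≫ Y.tgt = (r ≫ q ≫ y) ≫ Y.src := by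
      simpa using r ≫= H.comp_w hP.w
    have e1 : (l ≫ m) ≫ y = Y.comp (l ≫ p ≫ y) (l ≫ q ≫ y) wl := by
      rw [Category.assoc, hm.2.2, InternalCategoryData.precomp_comp]
    have e2 : (r ≫ m) ≫ y = Y.comp (r ≫ p ≫ y) (r ≫ q ≫ y) wr := by
      rw [Category.assoc, hm.2.2, InternalCategoryData.precomp_comp]
    have e3 : l ≫ q ≫ y = r ≫ p ≫ y := by rw [reassoc_of% hQ.w]
    -- Sources and targets match formally; the equality of the images in `Y` is associativity there.
    refine H.lift_mul_eq hP hm _ _ _ _ ?_ ?_ ?_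
    · simp [InternalCategoryData.comp, hm.1]
    · simp [InternalCategoryData.comp, hm.2.1]
    · have e4 : (hP.lift (l ≫ p) (r ≫ m) (by
          rw [Category.assoc, Category.assoc, hm.1, hP.w, reassoc_of% hQ.w]) ≫ m) ≫ y =
          Y.comp ((l ≫ p) ≫ y) ((r ≫ m) ≫ y) (H.comp_w (by
            rw [Category.assoc, Category.assoc, hm.1, hP.w, reassoc_of% hQ.w])) := by
        refine (Category.assoc _ _ _).trans ((congrArg _ hm.2.2).trans ?_)
        rw [InternalCategoryData.precomp_comp]
        apply InternalCategoryData.comp_congr <;> simp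
      refine Eq.trans ?_ e4.symm
      rw [InternalCategoryData.comp_congr _ e1 (Category.assoc _ _ _),
        InternalCategoryData.comp_congr _ (Category.assoc _ _ _) e2,
        InternalCategory.comp_assoc _ _ _ _ _ (by rw [e3, wr])]
      exact InternalCategoryData.comp_congr _ rfl (InternalCategoryData.comp_congr _ e3 rfl)

/-- The canonical functor from the base change of an internal category. -/
noncomputable def InternalCategory.baseChangeFunctor (H : IsArrowPullback Y j s t y)
    {P Q : S} {p q : P ⟶ B} {l r : Q ⟶ P}
    (hP : IsPullback p q t s) (hQ : IsPullback l r q p) {e : U ⟶ B} {m : P ⟶ B}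
    (he : e ≫ s = 𝟙 U ∧ e ≫ t = 𝟙 U ∧ e ≫ y = j ≫ Y.unit)
    (hm : m ≫ s = p ≫ s ∧ m ≫ t = q ≫ t ∧ m ≫ y = Y.comp (p ≫ y) (q ≫ y) (H.comp_w hP.w)) :
    InternalFunctor (Y.baseChange H hP hQ he hm) Y where
  obj := j
  arr := y
  arr_src := H.src
  arr_tgt := H.tgt
  unit_arr := he.2.2
  mul_arr := hm.2.2

end BaseChange

/-! ### Factoring through a fully faithful functor -/

section LocallySplit

variable {S : Type u} [Category.{v} S] [HasBinaryProducts S] {X Y B : InternalCategory S}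

/-- If each object of `Y` in the image of `u : B ⥤ Y` is isomorphic to one in the image of the fully
faithful functor `f`, via `a : f p ≅ u`, then `u` factors through `f` up to isomorphism. -/
theorem InternalFunctor.FullyFaithful.exists_factorization {f : InternalFunctor X Y}
    (hf : f.FullyFaithful) (u : InternalFunctor B Y) (p : B.obj ⟶ X.obj) (a a' : B.obj ⟶ Y.arr)
    (ha : Y.AreInverse a a') (hs : a ≫ Y.src = p ≫ f.obj) (ht : a ≫ Y.tgt = u.obj) :
    ∃ f' : InternalFunctor B X, Nonempty (InternalNatIso u (f'.comp f)) := by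
  obtain ⟨w, w', e, e'⟩ := ha
  have hs' : a' ≫ Y.src = u.obj := by rw [← w, ht]
  have ht' : a' ≫ Y.tgt = p ≫ f.obj := by rw [w', hs]
  have w1 : (B.src ≫ a) ≫ Y.tgt = u.arr ≫ Y.src := by rw [Category.assoc, ht, u.arr_src]
  have w2 : u.arr ≫ Y.tgt = (B.tgt ≫ a') ≫ Y.src := by rw [Category.assoc, hs', u.arr_tgt]
  -- Conjugation by `a`: an arrow from `b` to `b'` becomes `f (p b) ≅ u b ⟶ u b' ≅ f (p b')`. This
  -- has both ends in the image of `f`, so it lifts to `X`.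
  let c : B.arr ⟶ Y.arr := Y.comp (B.src ≫ a) (Y.comp u.arr (B.tgt ≫ a') w2)
    (by rw [InternalCategory.comp_src, w1])
  have aa' : Y.comp a a' w = (p ≫ f.obj) ≫ Y.unit := by rw [e, ← hs, Category.assoc]
  have a'a : Y.comp a' a w' = u.obj ≫ Y.unit := by rw [e', ← hs', Category.assoc]
  -- cancellation of `a' a` in the middle of a composite
  have cancel {T : S} (x : T ⟶ B.obj) (g h : T ⟶ Y.arr) (hg : g ≫ Y.tgt = x ≫ u.obj)
      (hh : x ≫ u.obj = h ≫ Y.src) :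
      Y.comp (Y.comp g (x ≫ a') (by rw [hg, Category.assoc, hs']))
        (Y.comp (x ≫ a) h (by rw [Category.assoc, ht, hh]))
        (by simp only [InternalCategory.comp_tgt, InternalCategory.comp_src, Category.assoc, w']) =
      Y.comp g h (hg.trans hh) := by
    rw [InternalCategory.comp_assoc _ _ _ _ _
      (by simp only [InternalCategory.comp_src, Category.assoc, w'])]
    refine InternalCategoryData.comp_congr _ rfl ?_
    rw [← InternalCategory.comp_assoc _ _ _ _ (by simp only [Category.assoc, w'])
      (by rw [Category.assoc, ht, hh])]
    refine (InternalCategoryData.comp_congr _ (g' := (x ≫ u.obj) ≫ Y.unit) (h' := h)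
      ?_ rfl).trans (Y.unit_comp _ _ hh)
    rw [← InternalCategoryData.precomp_comp _ _ _ _ w', a'a, Category.assoc]
  obtain ⟨F, Fs, Ft, Fc⟩ := hf.exists_lift (B.src ≫ p) (B.tgt ≫ p) c
    (by simp [c, hs]) (by simp [c, ht'])
  have wF : (B.fst ≫ F) ≫ X.tgt = (B.snd ≫ F) ≫ X.src := by
    rw [Category.assoc, Category.assoc, Fs, Ft, reassoc_of% B.isPullback_pairs.w]
  -- The isomorphism from `u` is `a'`, with inverse `a`. Functoriality is tested after applying `f`,
  -- where adjacent factors `a' a` cancel.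
  refine ⟨⟨p, F, Fs, Ft, ?_, ?_⟩, ⟨⟨⟨a', hs', ht', ?_⟩, ⟨a, hs, ht, ?_⟩, a'a, aa'⟩⟩⟩
  · apply hf.hom_ext
    · rw [Category.assoc, Fs, reassoc_of% B.unit_src, Category.assoc, X.unit_src, Category.comp_id]
    · rw [Category.assoc, Ft, reassoc_of% B.unit_tgt, Category.assoc, X.unit_tgt, Category.comp_id]
    · rw [Category.assoc, Fc, InternalCategoryData.precomp_comp, Category.assoc p, f.unit_arr,
        ← Category.assoc p, ← aa']
      apply InternalCategoryData.comp_congr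
      · rw [reassoc_of% B.unit_src]
      · rw [InternalCategoryData.precomp_comp]
        refine (InternalCategoryData.comp_congr _ (g' := u.obj ≫ Y.unit) (h' := a')
          u.unit_arr ?_).trans (Y.unit_comp _ _ hs'.symm)
        rw [reassoc_of% B.unit_tgt]
  · apply hf.hom_ext
    · rw [InternalCategory.comp_src, Category.assoc, Category.assoc, Fs, reassoc_of% B.mul_src]
    · rw [InternalCategory.comp_tgt, Category.assoc, Category.assoc, Ft, reassoc_of% B.mul_tgt]
    · rw [Category.assoc, Fc, f.comp_arr, InternalCategoryData.precomp_comp]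
      have e1 : (B.fst ≫ F) ≫ f.arr = Y.comp (B.fst ≫ B.src ≫ a) (B.fst ≫ Y.comp u.arr
          (B.tgt ≫ a') w2) (by simp only [Category.assoc, ht,
            InternalCategory.comp_src, u.arr_src]) := by
        rw [Category.assoc, Fc, InternalCategoryData.precomp_comp]
      have e2 : (B.snd ≫ F) ≫ f.arr = Y.comp ((B.snd ≫ B.src) ≫ a) (B.snd ≫ Y.comp u.arr
          (B.tgt ≫ a') w2) (by simp only [Category.assoc, ht,
            InternalCategory.comp_src, u.arr_src]) := by
        rw [Category.assoc, Fc, InternalCategoryData.precomp_comp]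
        apply InternalCategoryData.comp_congr <;> simp
      have e3 : B.fst ≫ Y.comp u.arr (B.tgt ≫ a') w2 = Y.comp (B.fst ≫ u.arr)
          ((B.snd ≫ B.src) ≫ a')
          (by simp only [Category.assoc, hs', u.arr_tgt, reassoc_of% B.isPullback_pairs.w]) := by
        rw [InternalCategoryData.precomp_comp]
        refine InternalCategoryData.comp_congr _ rfl ?_
        rw [reassoc_of% B.isPullback_pairs.w, Category.assoc]
      rw [InternalCategoryData.comp_congr _ e1 e2, InternalCategory.comp_assoc _ _ _ _ _
        (by simp only [InternalCategory.comp_tgt, InternalCategory.comp_src, Category.assoc, w',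
          reassoc_of% B.isPullback_pairs.w])]
      apply InternalCategoryData.comp_congr
      · rw [reassoc_of% B.mul_src]
      · rw [InternalCategoryData.comp_congr _ e3 rfl, cancel _ _ _ (by
          simp only [Category.assoc, u.arr_tgt, reassoc_of% B.isPullback_pairs.w]) (by
          simp only [Category.assoc, InternalCategory.comp_src, u.arr_src])]
        rw [InternalCategoryData.precomp_comp,
          InternalCategoryData.comp_congr _ u.mul_arr rfl,
          InternalCategoryData.comp_congr _ rfl (InternalCategoryData.precomp_comp _ _ _ _ w2),
          InternalCategory.comp_assoc _ _ _ _ _ (by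
            simp only [Category.assoc, u.arr_tgt, reassoc_of% B.mul_tgt, hs'])]
        refine InternalCategoryData.comp_congr _ rfl (InternalCategoryData.comp_congr _ rfl ?_)
        rw [reassoc_of% B.mul_tgt]
  · refine (InternalCategoryData.comp_congr _ rfl Fc).trans ?_
    rw [← InternalCategory.comp_assoc _ _ _ _ (by simp only [Category.assoc, w']) (by
      simp only [InternalCategory.comp_src, w1])]
    refine (InternalCategoryData.comp_congr _ (g' := (B.src ≫ u.obj) ≫ Y.unit)
      ?_ rfl).trans (Y.unit_comp _ _ (by simp [u.arr_src]))
    rw [← InternalCategoryData.precomp_comp _ _ _ _ w', a'a, Category.assoc]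
  · refine Eq.trans ?_ (InternalCategoryData.comp_congr _ Fc rfl).symm
    rw [InternalCategory.comp_assoc _ _ _ _ _ (by simp only [InternalCategory.comp_tgt,
      Category.assoc, w'])]
    refine InternalCategoryData.comp_congr _ rfl ?_
    rw [InternalCategory.comp_assoc _ _ _ _ _ (by simp only [Category.assoc, w'])]
    refine Eq.symm ((InternalCategoryData.comp_congr _ (h' := (B.tgt ≫ u.obj) ≫ Y.unit)
      rfl ?_).trans (Y.comp_unit _ _ (by simp [u.arr_tgt])))
    rw [← InternalCategoryData.precomp_comp _ _ _ _ w', a'a, Category.assoc]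

end LocallySplit

/-! ### Smooth maps, open submanifolds and points -/

namespace Diff

variable {M N K T : Diff.{u}}

instance : CoeFun (M ⟶ N) fun _ ↦ M.carrier → N.carrier := ⟨fun f ↦ Hom.toFun f⟩

theorem hom_ext {f g : M ⟶ N} (h : ∀ x, f x = g x) : f = g :=
  Hom.ext (funext h)

@[simp]
theorem comp_apply (f : M ⟶ N) (g : N ⟶ K) (x : M.carrier) : (f ≫ g) x = g (f x) := rfl

theorem congr_apply {f g : M ⟶ N} (h : f = g) (x : M.carrier) : f x = g x := by rw [h]

theorem smooth (f : M ⟶ N) : ContMDiff 𝓘(ℝ, M.E) 𝓘(ℝ, N.E) ∞ f := Hom.contMDiff f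

theorem continuous (f : M ⟶ N) : Continuous f := (smooth f).continuous

/-- The morphism given by a smooth map. -/
def homMk (f : M.carrier → N.carrier) (hf : ContMDiff 𝓘(ℝ, M.E) 𝓘(ℝ, N.E) ∞ f) : M ⟶ N :=
  Hom.mk f hf

section Opens

open TopologicalSpace (Opens)

/-- An open submanifold. -/
noncomputable def openSub (M : Diff.{u}) (U : Opens M.carrier) : Diff.{u} where
  carrier := U
  E := M.E

variable (U : Opens M.carrier)

/-- The inclusion of an open submanifold. -/
noncomputable def ι : openSub M U ⟶ M :=
  have h : ContMDiff 𝓘(ℝ, M.E) 𝓘(ℝ, M.E) ∞ (Subtype.val : U → M.carrier) := contMDiff_subtype_val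
  homMk (M := openSub M U) (Subtype.val : U → M.carrier) h

theorem ι_mem (x : (openSub M U).carrier) : ι U x ∈ U := Subtype.property (p := (· ∈ U)) x

theorem ι_injective : Function.Injective (ι U) := Subtype.val_injective

/-- A smooth map with values in an open set, as a map to the open submanifold. -/
noncomputable def openLift (f : T ⟶ M) (h : ∀ x, f x ∈ U) : T ⟶ openSub M U :=
  have h' : ContMDiff 𝓘(ℝ, T.E) 𝓘(ℝ, M.E) ∞ (fun x ↦ (⟨f x, h x⟩ : U)) :=
    (ContMDiff.subtypeVal_comp_iff U _).1 (smooth f)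
  homMk (N := openSub M U) (fun x ↦ (⟨f x, h x⟩ : U)) h'

@[simp]
theorem openLift_ι (f : T ⟶ M) (h : ∀ x, f x ∈ U) : openLift U f h ≫ ι U = f := rfl

/-- The restriction of a map which is smooth on an open set. -/
noncomputable def ofContMDiffOn (f : M.carrier → N.carrier)
    (hf : ContMDiffOn 𝓘(ℝ, M.E) 𝓘(ℝ, N.E) ∞ f U) : openSub M U ⟶ N :=
  have h : ContMDiff 𝓘(ℝ, M.E) 𝓘(ℝ, N.E) ∞ (fun x : U ↦ f x) := fun x ↦
    contMDiffAt_subtype_iff.2 (hf.contMDiffAt (U.isOpen.mem_nhds x.2))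
  homMk (M := openSub M U) (fun x : U ↦ f x) h

@[simp]
theorem ofContMDiffOn_apply (f : M.carrier → N.carrier)
    (hf : ContMDiffOn 𝓘(ℝ, M.E) 𝓘(ℝ, N.E) ∞ f U) (x : (openSub M U).carrier) :
    ofContMDiffOn U f hf x = f (ι U x) := rfl

end Opens

section Vec

/-- Model spaces live in `Type` and carriers in `Type u`. The lift of a vector space gets its
manifold structure from this one global chart. -/
theorem isOpenEmbedding_down (F : Type) [TopologicalSpace F] :
    Topology.IsOpenEmbedding (ULift.down : ULift.{u} F → F) :=
  Homeomorph.ulift.isOpenEmbedding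

variable (F : Type) [NormedAddCommGroup F] [NormedSpace ℝ F] [FiniteDimensional ℝ F]

/-- A finite-dimensional vector space as a manifold. -/
noncomputable def vec : Diff.{u} where
  carrier := ULift.{u} F
  E := F
  chartedSpace := (isOpenEmbedding_down F).singletonChartedSpace
  isManifold := (isOpenEmbedding_down F).isManifold_singleton
  t2Space := (isOpenEmbedding_down F).isEmbedding.t2Space
  secondCountableTopology := (isOpenEmbedding_down F).isEmbedding.secondCountableTopology

variable {F} in
/-- An element of `vec F` as a vector. -/
def vecDown (x : (vec.{u} F).carrier) : F := ULift.down (α := F) x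

variable {F} in
/-- A vector as an element of `vec F`. -/
def vecUp (x : F) : (vec.{u} F).carrier := ULift.up x

theorem contMDiff_vecDown : ContMDiff 𝓘(ℝ, (vec.{u} F).E) 𝓘(ℝ, F) ∞
    (vecDown : (vec.{u} F).carrier → F) := by
  let : ChartedSpace F (ULift.{u} F) := (isOpenEmbedding_down F).singletonChartedSpace
  have h : ContMDiff 𝓘(ℝ, F) 𝓘(ℝ, F) ∞ (ULift.down : ULift.{u} F → F) :=
    contMDiff_isOpenEmbedding (isOpenEmbedding_down F)
  exact h

theorem contMDiff_vecUp : ContMDiff 𝓘(ℝ, F) 𝓘(ℝ, (vec.{u} F).E) ∞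
    (vecUp : F → (vec.{u} F).carrier) := by
  let : ChartedSpace F (ULift.{u} F) := (isOpenEmbedding_down F).singletonChartedSpace
  have h := contMDiffOn_isOpenEmbedding_symm (I := 𝓘(ℝ, F)) (n := ∞) (isOpenEmbedding_down.{u} F)
  rw [show Set.range (ULift.down : ULift.{u} F → F) = Set.univ from ULift.down_surjective.range_eq,
    contMDiffOn_univ] at h
  have h' : ContMDiff 𝓘(ℝ, F) 𝓘(ℝ, F) ∞ (ULift.up : F → ULift.{u} F) := by
    convert! h using 1
    funext x
    apply ULift.down_injective
    symm
    exact Topology.IsOpenEmbedding.toOpenPartialHomeomorph_right_inv _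
      (isOpenEmbedding_down.{u} F) ⟨ULift.up x, rfl⟩
  exact h'

/-- The one-point manifold. -/
noncomputable def pt : Diff.{u} := vec PUnit

instance : Unique pt.{u}.carrier := inferInstanceAs (Unique (ULift.{u} PUnit))

/-- A constant map. -/
def const (x : N.carrier) : M ⟶ N := homMk (fun _ ↦ x) contMDiff_const

theorem const_comp (f : M ⟶ N) (x : M.carrier) : (const x : T ⟶ M) ≫ f = const (f x) := rfl

theorem eq_const (f : pt ⟶ M) : f = const (f default) :=
  hom_ext fun x ↦ by rw [Unique.eq_default x]; rfl

end Vec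

section Prod

@[simp]
theorem prodLift_fst (f : T ⟶ M) (g : T ⟶ N) : prodLift f g ≫ prodFst M N = f := rfl

@[simp]
theorem prodLift_snd (f : T ⟶ M) (g : T ⟶ N) : prodLift f g ≫ prodSnd M N = g := rfl

end Prod

section Points

variable {P : Diff.{u}} {p : P ⟶ M} {q : P ⟶ N} {f : M ⟶ K} {g : N ⟶ K}

/-- Points are maps from `pt`, so a categorical pullback has the expected points, whatever its
construction. -/
theorem exists_point_of_isPullback (h : IsPullback p q f g) {x : M.carrier} {y : N.carrier}
    (e : f x = g y) : ∃ z, p z = x ∧ q z = y := by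
  have w : (const x : pt ⟶ M) ≫ f = (const y : pt ⟶ N) ≫ g := by
    rw [const_comp, const_comp, e]
  exact ⟨h.lift _ _ w default, congr_apply (h.lift_fst _ _ w) default,
    congr_apply (h.lift_snd _ _ w) default⟩

end Points

end Diff

/-! ### Derivatives and local product presentations -/

namespace Diff

variable {M N K T : Diff.{u}}

section Derivative

theorem mdifferentiableAt (f : M ⟶ N) (x : M.carrier) :
    MDifferentiableAt 𝓘(ℝ, M.E) 𝓘(ℝ, N.E) f x :=
  (smooth f).mdifferentiableAt (by simp)

/-- The derivative of a smooth map at a point. -/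
noncomputable def deriv (f : M ⟶ N) (x : M.carrier) : M.E →L[ℝ] N.E :=
  mfderiv 𝓘(ℝ, M.E) 𝓘(ℝ, N.E) f x

theorem deriv_comp (f : M ⟶ N) (g : N ⟶ K) (x : M.carrier) :
    deriv (f ≫ g) x = (deriv g (f x)).comp (deriv f x) :=
  mfderiv_comp (I := 𝓘(ℝ, M.E)) (I' := 𝓘(ℝ, N.E)) (I'' := 𝓘(ℝ, K.E)) x
    (mdifferentiableAt g (f x)) (mdifferentiableAt f x)

theorem deriv_const (y : N.carrier) (x : M.carrier) : deriv (const y : M ⟶ N) x = 0 :=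
  mfderiv_const

/-- The derivative of `f` at `x` is surjective. -/
def SubmAt (f : M ⟶ N) (x : M.carrier) : Prop :=
  Function.Surjective (deriv f x)

theorem SubmAt.comp {f : M ⟶ N} {g : N ⟶ K} {x : M.carrier} (hf : SubmAt f x)
    (hg : SubmAt g (f x)) : SubmAt (f ≫ g) x := by
  rw [SubmAt, deriv_comp]
  change Function.Surjective (deriv g (f x) ∘ deriv f x)
  exact Function.Surjective.comp hg hf

theorem SubmAt.of_comp {f : M ⟶ N} {g : N ⟶ K} {x : M.carrier} (h : SubmAt (f ≫ g) x) :
    SubmAt g (f x) := by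
  rw [SubmAt, deriv_comp] at h
  exact Function.Surjective.of_comp h

/-- A smooth map with a local smooth section through `x` is submersive at `x`. -/
theorem submAt_of_section (f : M ⟶ N) (x : M.carrier) (σ : N.carrier → M.carrier)
    (hσ : ContMDiffAt 𝓘(ℝ, N.E) 𝓘(ℝ, M.E) ∞ σ (f x)) (hx : σ (f x) = x)
    (h : ∀ᶠ y in nhds (f x), f (σ y) = y) : SubmAt f x := by
  have hd : MDifferentiableAt 𝓘(ℝ, N.E) 𝓘(ℝ, M.E) σ (f x) := hσ.mdifferentiableAt (by simp)
  have hfd : MDifferentiableAt 𝓘(ℝ, M.E) 𝓘(ℝ, N.E) f (σ (f x)) := mdifferentiableAt f _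
  have h1 : HasMFDerivAt 𝓘(ℝ, N.E) 𝓘(ℝ, N.E) ((f : M.carrier → N.carrier) ∘ σ) (f x)
      ((mfderiv 𝓘(ℝ, M.E) 𝓘(ℝ, N.E) f (σ (f x))).comp (mfderiv 𝓘(ℝ, N.E) 𝓘(ℝ, M.E) σ (f x))) :=
    hfd.hasMFDerivAt.comp (f x) hd.hasMFDerivAt
  have h2 : HasMFDerivAt 𝓘(ℝ, N.E) 𝓘(ℝ, N.E) ((f : M.carrier → N.carrier) ∘ σ) (f x)
      (ContinuousLinearMap.id ℝ N.E) :=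
    (hasMFDerivAt_id (f x)).congr_of_eventuallyEq h
  intro v
  refine ⟨mfderiv 𝓘(ℝ, N.E) 𝓘(ℝ, M.E) σ (f x) v, ?_⟩
  have h3 := congrArg (fun L : N.E →L[ℝ] N.E ↦ L v) (hasMFDerivAt_unique h1 h2)
  have h4 : deriv f (σ (f x)) (mfderiv 𝓘(ℝ, N.E) 𝓘(ℝ, M.E) σ (f x) v) = v := h3
  rwa [hx] at h4

end Derivative

/-- A presentation of `f` near `x` as the projection of a product `N × F`. -/
structure LocalProduct (F : Type) [NormedAddCommGroup F] [NormedSpace ℝ F] (f : M ⟶ N)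
    (x : M.carrier) where
  source : TopologicalSpace.Opens M.carrier
  mem_source : x ∈ source
  target : Set (N.carrier × F)
  isOpen_target : IsOpen target
  snd : M.carrier → F
  contMDiffOn_snd : ContMDiffOn 𝓘(ℝ, M.E) 𝓘(ℝ, F) ∞ snd source
  symm : N.carrier × F → M.carrier
  contMDiffOn_symm : ContMDiffOn (𝓘(ℝ, N.E).prod 𝓘(ℝ, F)) 𝓘(ℝ, M.E) ∞ symm target
  map_source : ∀ y ∈ source, (f y, snd y) ∈ target
  left_inv : ∀ y ∈ source, symm (f y, snd y) = y
  map_target : ∀ p ∈ target, symm p ∈ source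
  fst_symm : ∀ p ∈ target, f (symm p) = p.1
  snd_symm : ∀ p ∈ target, snd (symm p) = p.2

theorem exists_normalForm {F : Type} [NormedAddCommGroup F] [NormedSpace ℝ F] {f : M ⟶ N}
    {x : M.carrier}
    (h : Manifold.IsSubmersionAtOfComplement F 𝓘(ℝ, M.E) 𝓘(ℝ, N.E) ∞ f x) :
    ∃ φ ∈ IsManifold.maximalAtlas 𝓘(ℝ, M.E) ∞ M.carrier,
    ∃ ψ ∈ IsManifold.maximalAtlas 𝓘(ℝ, N.E) ∞ N.carrier, ∃ e : M.E ≃L[ℝ] N.E × F,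
      x ∈ φ.source ∧ (∀ y ∈ φ.source, f y ∈ ψ.source) ∧ ∀ y ∈ φ.source, ψ (f y) = (e (φ y)).1 := by
  refine ⟨h.domChart, h.domChart_mem_maximalAtlas, h.codChart, h.codChart_mem_maximalAtlas,
    h.equiv, h.mem_domChart_source, fun y hy ↦ h.source_subset_preimage_source hy, fun y hy ↦ ?_⟩
  have := h.writtenInCharts (show h.domChart y ∈ (h.domChart.extend 𝓘(ℝ, M.E)).target by
    simpa using h.domChart.map_source hy)
  simpa [h.domChart.left_inv hy] using this

/-- In the normal form `f` is a linear projection between charts. Undoing only the codomain chart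
makes the first coordinate a point of `N` itself, and leaves the `F`-component of `e ∘ φ` as the
second. -/
theorem nonempty_localProduct {F : Type} [NormedAddCommGroup F] [NormedSpace ℝ F] {f : M ⟶ N}
    {x : M.carrier}
    (h : Manifold.IsSubmersionAtOfComplement F 𝓘(ℝ, M.E) 𝓘(ℝ, N.E) ∞ f x) :
    Nonempty (LocalProduct F f x) := by
  obtain ⟨φ, hφ, ψ, hψ, e, hx, hs, hf⟩ := exists_normalForm h
  have hg : ContMDiffOn (𝓘(ℝ, N.E).prod 𝓘(ℝ, F)) 𝓘(ℝ, M.E) ∞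
      (fun p : N.carrier × F ↦ e.symm (ψ p.1, p.2)) (Prod.fst ⁻¹' ψ.source) := by
    have h1 : ContMDiffOn (𝓘(ℝ, N.E).prod 𝓘(ℝ, F)) 𝓘(ℝ, N.E) ∞
        (fun p : N.carrier × F ↦ ψ p.1) (Prod.fst ⁻¹' ψ.source) :=
      (contMDiffOn_of_mem_maximalAtlas hψ).comp contMDiffOn_fst fun p hp ↦ hp
    have h2 : ContMDiffOn (𝓘(ℝ, N.E).prod 𝓘(ℝ, F)) 𝓘(ℝ, N.E × F) ∞
        (fun p : N.carrier × F ↦ (ψ p.1, p.2)) (Prod.fst ⁻¹' ψ.source) :=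
      h1.prodMk_space contMDiffOn_snd
    exact e.symm.contDiff.contMDiff.comp_contMDiffOn h2
  have ho : IsOpen (Prod.fst ⁻¹' ψ.source : Set (N.carrier × F)) :=
    ψ.open_source.preimage continuous_fst
  have hV := hg.continuousOn.isOpen_inter_preimage ho φ.open_target
  exact ⟨{
    source := ⟨φ.source, φ.open_source⟩
    mem_source := hx
    target := _
    isOpen_target := hV
    snd := fun y ↦ (e (φ y)).2
    contMDiffOn_snd := (contDiff_snd.comp e.contDiff).contMDiff.comp_contMDiffOn
      (contMDiffOn_of_mem_maximalAtlas hφ)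
    symm := fun p ↦ φ.symm (e.symm (ψ p.1, p.2))
    contMDiffOn_symm := (contMDiffOn_symm_of_mem_maximalAtlas hφ).comp
      (hg.mono Set.inter_subset_left) fun p hp ↦ hp.2
    map_source := fun y hy ↦ ⟨hs y hy, by
      simpa [hf y hy] using φ.map_source hy⟩
    left_inv := fun y hy ↦ by
      have : (ψ (f y), (e (φ y)).2) = e (φ y) := by rw [hf y hy]
      rw [this, e.symm_apply_apply, φ.left_inv hy]
    map_target := fun p hp ↦ φ.map_target hp.2
    fst_symm := fun p hp ↦ by
      apply ψ.injOn (hs _ (φ.map_target hp.2)) hp.1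
      rw [hf _ (φ.map_target hp.2), φ.right_inv hp.2, e.apply_symm_apply]
    snd_symm := fun p hp ↦ by
      rw [φ.right_inv hp.2, e.apply_symm_apply] }⟩

namespace LocalProduct

variable {F : Type} [NormedAddCommGroup F] [NormedSpace ℝ F] {f : M ⟶ N} {x : M.carrier}
  (L : LocalProduct F f x)

/-- The domain of the section through `x`. -/
def base : TopologicalSpace.Opens N.carrier :=
  ⟨(fun n ↦ (n, L.snd x)) ⁻¹' L.target, L.isOpen_target.preimage (by fun_prop)⟩

theorem mem_base : f x ∈ L.base := L.map_source x L.mem_source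

theorem contMDiffOn_section : ContMDiffOn 𝓘(ℝ, N.E) 𝓘(ℝ, M.E) ∞
    (fun n ↦ L.symm (n, L.snd x)) L.base :=
  L.contMDiffOn_symm.comp (contMDiffOn_id.prodMk contMDiffOn_const) fun _ hn ↦ hn

include L in
theorem submAt : SubmAt f x := by
  refine submAt_of_section f x (fun n ↦ L.symm (n, L.snd x))
    (L.contMDiffOn_section.contMDiffAt (L.base.isOpen.mem_nhds L.mem_base))
    (L.left_inv x L.mem_source) ?_
  filter_upwards [L.base.isOpen.mem_nhds L.mem_base] with n hn
  exact L.fst_symm _ hn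

end LocalProduct

/-- Any point of `M` exhibits the complement as a quotient of `M.E`, hence finite-dimensional. If
`M` is empty, the zero space will do. -/
theorem IsSubmersion.exists_complement {f : M ⟶ N} (hf : IsSubmersion f) :
    ∃ (F : Type) (_ : NormedAddCommGroup F) (_ : NormedSpace ℝ F) (_ : FiniteDimensional ℝ F),
      Manifold.IsSubmersionOfComplement F 𝓘(ℝ, M.E) 𝓘(ℝ, N.E) ∞ f := by
  by_cases hM : Nonempty M.carrier
  · obtain ⟨F, _, _, h⟩ := hf
    obtain ⟨x⟩ := hM
    obtain ⟨_, _, _, _, e, _⟩ := exists_normalForm (h x)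
    exact ⟨F, _, _, Module.Finite.of_surjective
      ((LinearMap.snd ℝ N.E F).comp e.toLinearEquiv.toLinearMap)
      (Prod.snd_surjective.comp e.surjective), h⟩
  · exact ⟨PUnit, inferInstance, inferInstance, inferInstance, fun x ↦ (hM ⟨x⟩).elim⟩

end Diff

/-! ### The pointwise criterion for submersions -/

namespace Diff

variable {M N K T : Diff.{u}}

/-- Pair `L` with a linear projection onto its kernel, identified with `F` by dimension; the result
is injective between spaces of equal dimension. -/
theorem _root_.ContinuousLinearMap.exists_equiv_prod {E E' F : Type*}
    [NormedAddCommGroup E] [NormedSpace ℝ E] [FiniteDimensional ℝ E]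
    [NormedAddCommGroup E'] [NormedSpace ℝ E'] [FiniteDimensional ℝ E']
    [NormedAddCommGroup F] [NormedSpace ℝ F] [FiniteDimensional ℝ F]
    (L : E →L[ℝ] E') (hL : Function.Surjective L)
    (hd : Module.finrank ℝ E = Module.finrank ℝ E' + Module.finrank ℝ F) :
    ∃ e : E ≃L[ℝ] E' × F, ∀ v, (e v).1 = L v := by
  let l : E →ₗ[ℝ] E' := L.toLinearMap
  have hk : Module.finrank ℝ (LinearMap.ker l) = Module.finrank ℝ F := by
    have h1 := LinearMap.finrank_range_add_finrank_ker l
    rw [LinearMap.range_eq_top.2 hL, finrank_top] at h1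
    omega
  let c := LinearEquiv.ofFinrankEq (LinearMap.ker l) F hk
  obtain ⟨p, hp⟩ := LinearMap.exists_leftInverse_of_injective (LinearMap.ker l).subtype
    (Submodule.ker_subtype _)
  let g : E →ₗ[ℝ] E' × F := l.prod (c.toLinearMap ∘ₗ p)
  have hg : Function.Injective g := by
    rw [injective_iff_map_eq_zero]
    intro v hv
    have h1 : l v = 0 := congrArg Prod.fst hv
    have h2 : c (p v) = 0 := congrArg Prod.snd hv
    have h3 : p v = ⟨v, h1⟩ := LinearMap.congr_fun hp ⟨v, h1⟩
    rw [LinearEquiv.map_eq_zero_iff, h3] at h2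
    exact congrArg Subtype.val h2
  refine ⟨(LinearEquiv.ofInjectiveOfFinrankEq g hg
    (by rw [Module.finrank_prod, hd])).toContinuousLinearEquiv, fun v ↦ rfl⟩

/-- A smooth map with surjective derivative is the first component of a linear isomorphism after a
local diffeomorphism. -/
theorem _root_.ContDiffOn.exists_straightening {E E' F : Type*}
    [NormedAddCommGroup E] [NormedSpace ℝ E] [FiniteDimensional ℝ E]
    [NormedAddCommGroup E'] [NormedSpace ℝ E'] [FiniteDimensional ℝ E']
    [NormedAddCommGroup F] [NormedSpace ℝ F] [FiniteDimensional ℝ F]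
    {f : E → E'} {Ω : Set E} (hΩ : IsOpen Ω) (hf : ContDiffOn ℝ ∞ f Ω) {x : E} (hx : x ∈ Ω)
    (hL : Function.Surjective (fderiv ℝ f x))
    (hd : Module.finrank ℝ E = Module.finrank ℝ E' + Module.finrank ℝ F) :
    ∃ (e : E ≃L[ℝ] E' × F) (τ : OpenPartialHomeomorph E E), x ∈ τ.source ∧ τ.source ⊆ Ω ∧
      ContDiffOn ℝ ∞ τ τ.source ∧ ContDiffOn ℝ ∞ τ.symm τ.target ∧
      ∀ v ∈ τ.source, (e (τ v)).1 = f v := by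
  obtain ⟨e, he⟩ := (fderiv ℝ f x).exists_equiv_prod (F := F) hL hd
  -- Replacing the first component of `e` by `f` gives a map with derivative the identity at `x`,
  -- since that component is the derivative of `f` there. The inverse function theorem applies to
  -- it.
  let G : E → E := fun v ↦ e.symm (f v, (e v).2)
  have hG : ContDiffOn ℝ ∞ G Ω :=
    e.symm.contDiff.comp_contDiffOn (hf.prodMk (contDiff_snd.comp e.contDiff).contDiffOn)
  have hGx : HasFDerivAt G ((ContinuousLinearEquiv.refl ℝ E : E ≃L[ℝ] E) : E →L[ℝ] E) x := by
    have h1 : HasFDerivAt f (fderiv ℝ f x) x :=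
      ((hf.contDiffAt (hΩ.mem_nhds hx)).differentiableAt (by simp)).hasFDerivAt
    have h2 : HasFDerivAt (fun v ↦ (e v).2) ((ContinuousLinearMap.snd ℝ E' F).comp
        (e : E →L[ℝ] E' × F)) x :=
      ((ContinuousLinearMap.snd ℝ E' F).comp (e : E →L[ℝ] E' × F)).hasFDerivAt
    have h3 := (e.symm : (E' × F) →L[ℝ] E).hasFDerivAt.comp x (h1.prodMk h2)
    refine HasFDerivAt.congr_fderiv h3 ?_
    ext v
    have : (fderiv ℝ f x v, (e v).2) = e v := Prod.ext (he v).symm rfl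
    simpa using congrArg e.symm this
  have hGa := hG.contDiffAt (hΩ.mem_nhds hx)
  let Φ := hGa.toOpenPartialHomeomorph G hGx (by simp)
  -- Invertibility of the derivative is kept at every point, so that the local inverse is smooth on
  -- its whole domain and not just at the image of `x`.
  let Ω' : Set E := Ω ∩ fderiv ℝ G ⁻¹' Set.range ((↑) : (E ≃L[ℝ] E) → E →L[ℝ] E)
  have hΩ' : IsOpen Ω' :=
    (hG.continuousOn_fderiv_of_isOpen hΩ (by simp)).isOpen_inter_preimage hΩ
      ContinuousLinearEquiv.isOpen
  have hxs : x ∈ Φ.source := hGa.mem_toOpenPartialHomeomorph_source hGx (by simp)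
  refine ⟨e, Φ.restrOpen Ω' hΩ', ⟨hxs, hx, ⟨_, hGx.fderiv.symm⟩⟩, fun v hv ↦ hv.2.1,
    hG.mono fun v hv ↦ hv.2.1, fun v hv ↦ ?_, fun v hv ↦ ?_⟩
  · have hs := (Φ.restrOpen Ω' hΩ').map_target hv
    obtain ⟨A, hA⟩ := hs.2.2
    have hGs := hG.contDiffAt (hΩ.mem_nhds hs.2.1)
    refine ContDiffAt.contDiffWithinAt ?_
    refine OpenPartialHomeomorph.contDiffAt_symm (f₀' := A) _ hv ?_ hGs
    rw [hA]
    exact (hGs.differentiableAt (by simp)).hasFDerivAt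
  · change (e (e.symm (f v, (e v).2))).1 = f v
    rw [e.apply_symm_apply]

/-- Straighten `f` in charts: following the domain chart by `τ` gives another chart of the maximal
atlas, in which `f` is a linear projection. -/
theorem SubmAt.isSubmersionAtOfComplement {F : Type} [NormedAddCommGroup F] [NormedSpace ℝ F]
    [FiniteDimensional ℝ F] {f : M ⟶ N} {x : M.carrier} (h : SubmAt f x)
    (hd : Module.finrank ℝ M.E = Module.finrank ℝ N.E + Module.finrank ℝ F) :
    Manifold.IsSubmersionAtOfComplement F 𝓘(ℝ, M.E) 𝓘(ℝ, N.E) ∞ f x := by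
  let φ := chartAt M.E x
  let ψ := chartAt N.E (f x)
  let g : M.E → N.E := fun v ↦ ψ (f (φ.symm v))
  have hφ : φ ∈ IsManifold.maximalAtlas 𝓘(ℝ, M.E) ∞ M.carrier :=
    IsManifold.chart_mem_maximalAtlas x
  have hψ : ψ ∈ IsManifold.maximalAtlas 𝓘(ℝ, N.E) ∞ N.carrier :=
    IsManifold.chart_mem_maximalAtlas (f x)
  have hc : ContMDiffOn 𝓘(ℝ, M.E) 𝓘(ℝ, N.E) ∞ (fun v ↦ f (φ.symm v)) φ.target :=
    (smooth f).comp_contMDiffOn (contMDiffOn_symm_of_mem_maximalAtlas hφ)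
  have hΩ : IsOpen (φ.target ∩ (fun v ↦ f (φ.symm v)) ⁻¹' ψ.source) :=
    hc.continuousOn.isOpen_inter_preimage φ.open_target ψ.open_source
  have hg : ContDiffOn ℝ ∞ g (φ.target ∩ (fun v ↦ f (φ.symm v)) ⁻¹' ψ.source) := by
    rw [← contMDiffOn_iff_contDiffOn]
    exact (contMDiffOn_of_mem_maximalAtlas hψ).comp (hc.mono Set.inter_subset_left)
      fun v hv ↦ hv.2
  have hxs : x ∈ φ.source := mem_chart_source _ x
  have hx : φ x ∈ φ.target ∩ (fun v ↦ f (φ.symm v)) ⁻¹' ψ.source :=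
    ⟨φ.map_source hxs, by
      rw [Set.mem_preimage, φ.left_inv hxs]
      exact mem_chart_source N.E (f x)⟩
  have hL : Function.Surjective (fderiv ℝ g (φ x)) := by
    have h1 : deriv f x = fderiv ℝ g (φ x) := by
      rw [deriv, (mdifferentiableAt f x).mfderiv]
      simp only [ModelWithCorners.range_eq_univ, fderivWithin_univ]
      rfl
    rw [← h1]
    exact h
  obtain ⟨e, τ, hxτ, hτ, hτs, hτt, heτ⟩ := hg.exists_straightening (F := F) hΩ hx hL hd
  refine Manifold.IsSubmersionAtOfComplement.mk_of_continuousAt (continuous f).continuousAt e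
    (φ.trans τ) ψ ⟨hxs, hxτ⟩ (mem_chart_source _ _) ?_ hψ ?_
  · apply OpenPartialHomeomorph.mem_maximalAtlas_of_contMDiffOn
    · exact (contMDiffOn_iff_contDiffOn.2 hτs).comp
        ((contMDiffOn_of_mem_maximalAtlas hφ).mono fun y hy ↦ hy.1) fun y hy ↦ hy.2
    · exact (contMDiffOn_symm_of_mem_maximalAtlas hφ).comp
        ((contMDiffOn_iff_contDiffOn.2 hτt).mono fun y hy ↦ hy.1) fun y hy ↦ hy.2
  · intro v hv
    have hv' : v ∈ (φ.trans τ).target := by simpa using hv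
    have := heτ _ (τ.map_target hv'.1)
    rw [τ.right_inv hv'.1] at this
    simpa [g] using this.symm

theorem IsSubmersion.submAt {f : M ⟶ N} (hf : IsSubmersion f) (x : M.carrier) : SubmAt f x := by
  obtain ⟨F, _, _, h⟩ := hf
  exact (nonempty_localProduct (h x)).some.submAt

theorem SubmAt.exists_finrank_eq {f : M ⟶ N} {x : M.carrier} (h : SubmAt f x) :
    ∃ n : ℕ, Module.finrank ℝ M.E = Module.finrank ℝ N.E +
      Module.finrank ℝ (EuclideanSpace ℝ (Fin n)) := by
  refine ⟨Module.finrank ℝ M.E - Module.finrank ℝ N.E, ?_⟩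
  have := LinearMap.finrank_le_finrank_of_surjective (f := (deriv f x).toLinearMap) h
  rw [finrank_euclideanSpace_fin]
  omega

/-- Since `M` and `N` have fixed dimensions, the complement found at one point has the right
dimension at all others. -/
theorem isSubmersion_iff {f : M ⟶ N} : IsSubmersion f ↔ ∀ x, SubmAt f x := by
  refine ⟨fun h ↦ h.submAt, fun h ↦ ?_⟩
  by_cases hM : Nonempty M.carrier
  · obtain ⟨x⟩ := hM
    obtain ⟨n, hn⟩ := (h x).exists_finrank_eq
    exact ⟨EuclideanSpace ℝ (Fin n), inferInstance, inferInstance,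
      fun y ↦ (h y).isSubmersionAtOfComplement hn⟩
  · exact ⟨PUnit, inferInstance, inferInstance, fun x ↦ (hM ⟨x⟩).elim⟩

/-- For a complement of the right dimension, surjectivity of the derivative is equivalent to the
local normal form, which is an open condition. -/
theorem isOpen_submAt (f : M ⟶ N) : IsOpen {x | SubmAt f x} := by
  by_cases hM : ∃ x, SubmAt f x
  · obtain ⟨x, hx⟩ := hM
    obtain ⟨n, hn⟩ := hx.exists_finrank_eq
    convert isOpen_isSubmersionAtOfComplement (F := EuclideanSpace ℝ (Fin n))
      (I := 𝓘(ℝ, M.E)) (J := 𝓘(ℝ, N.E)) (n := ∞) (f := (f : M.carrier → N.carrier)) using 2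
    funext y
    exact propext ⟨fun hy ↦ hy.isSubmersionAtOfComplement hn,
      fun hy ↦ (nonempty_localProduct hy).some.submAt⟩
  · convert isOpen_empty
    ext x
    exact ⟨fun h ↦ hM ⟨x, h⟩, fun h ↦ h.elim⟩

theorem SubmAt.exists_section {f : M ⟶ N} {x : M.carrier} (h : SubmAt f x) :
    ∃ (V : TopologicalSpace.Opens N.carrier) (σ : openSub N V ⟶ M), f x ∈ V ∧
      (∀ y, ι V y = f x → σ y = x) ∧ σ ≫ f = ι V := by
  obtain ⟨n, hn⟩ := h.exists_finrank_eq
  obtain ⟨L⟩ := nonempty_localProduct (h.isSubmersionAtOfComplement hn)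
  refine ⟨L.base, ofContMDiffOn _ _ L.contMDiffOn_section, L.mem_base, fun y hy ↦ ?_,
    hom_ext fun y ↦ L.fst_symm _ (ι_mem L.base y)⟩
  rw [ofContMDiffOn_apply, hy, L.left_inv x L.mem_source]

theorem submAt_ι (U : TopologicalSpace.Opens M.carrier) (x : (openSub M U).carrier) :
    SubmAt (ι U) x := by
  classical
  -- Only the germ of `σ` at the given point matters; the value `x` off `U` is arbitrary.
  let σ : M.carrier → U := fun y ↦ if h : y ∈ U then ⟨y, h⟩ else x
  have hσ' : ∀ᶠ y in nhds (ι U x), (σ y).1 = y := by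
    filter_upwards [U.isOpen.mem_nhds (ι_mem U x)] with y hy
    simp [σ, show y ∈ U from hy]
  have hσ : ContMDiffAt 𝓘(ℝ, M.E) 𝓘(ℝ, M.E) ∞ σ (ι U x) := by
    rw [← ContMDiffAt.subtypeVal_comp_iff]
    exact contMDiffAt_id.congr_of_eventuallyEq hσ'
  exact submAt_of_section (ι U) x σ hσ (ι_injective U hσ'.self_of_nhds) hσ'

end Diff

/-! ### Pullbacks along submersions -/

namespace Diff

variable {M N K T : Diff.{u}}

namespace FibreProduct

variable (f : M ⟶ N) (g : K ⟶ N)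

/-- The underlying space of the fibre product. -/
abbrev Carrier : Type u := {x : M.carrier × K.carrier // f x.1 = g x.2}

variable {f g} {F : Type} [NormedAddCommGroup F] [NormedSpace ℝ F]

/-- The chart of the fibre product given by a chart of the first factor and a presentation of the
second map as a projection. -/
noncomputable def chart (φ : OpenPartialHomeomorph M.carrier M.E) {y : K.carrier}
    (L : LocalProduct F g y) (x₀ : Carrier f g) : OpenPartialHomeomorph (Carrier f g) (M.E × F) where
  toFun x := (φ x.1.1, L.snd x.1.2)
  -- On the target the matching condition holds by `fst_symm`; elsewhere `x₀` is a filler.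
  invFun v := by
    classical
    exact if h : f (φ.symm v.1) = g (L.symm (f (φ.symm v.1), v.2)) then
      ⟨(φ.symm v.1, L.symm (f (φ.symm v.1), v.2)), h⟩ else x₀
  source := {x | x.1.1 ∈ φ.source ∧ x.1.2 ∈ L.source}
  target := {v | v.1 ∈ φ.target ∧ (f (φ.symm v.1), v.2) ∈ L.target}
  map_source' x hx := ⟨φ.map_source hx.1, by
    have := L.map_source _ hx.2
    rwa [φ.left_inv hx.1, x.2]⟩
  map_target' v hv := by
    rw [dif_pos (L.fst_symm _ hv.2).symm]
    exact ⟨φ.map_target hv.1, L.map_target _ hv.2⟩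
  left_inv' x hx := by
    have h1 : φ.symm (φ x.1.1) = x.1.1 := φ.left_inv hx.1
    have h2 : L.symm (f (φ.symm (φ x.1.1)), L.snd x.1.2) = x.1.2 := by
      rw [h1, x.2, L.left_inv _ hx.2]
    rw [dif_pos (by rw [h2, h1, x.2])]
    exact Subtype.ext (Prod.ext h1 h2)
  right_inv' v hv := by
    rw [dif_pos (L.fst_symm _ hv.2).symm]
    exact Prod.ext (φ.right_inv hv.1) (L.snd_symm _ hv.2)
  open_source := (φ.open_source.preimage (continuous_fst.comp continuous_subtype_val)).inter
    (L.source.isOpen.preimage (continuous_snd.comp continuous_subtype_val))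
  open_target := by
    have h1 : ContinuousOn (fun v : M.E × F ↦ (f (φ.symm v.1), v.2)) (Prod.fst ⁻¹' φ.target) :=
      ((continuous f).comp_continuousOn (φ.continuousOn_symm.comp continuous_fst.continuousOn
        fun v hv ↦ hv)).prodMk continuous_snd.continuousOn
    exact h1.isOpen_inter_preimage (φ.open_target.preimage continuous_fst) L.isOpen_target
  continuousOn_toFun := by
    refine ContinuousOn.prodMk ?_ ?_
    · exact φ.continuousOn.comp (continuous_fst.comp continuous_subtype_val).continuousOn
        fun x hx ↦ hx.1
    · exact L.contMDiffOn_snd.continuousOn.comp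
        (continuous_snd.comp continuous_subtype_val).continuousOn fun x hx ↦ hx.2
  continuousOn_invFun := by
    have hi : Topology.IsInducing (Subtype.val : Carrier f g → M.carrier × K.carrier) :=
      Topology.IsInducing.subtypeVal
    rw [hi.continuousOn_iff]
    have h0 : ContinuousOn (fun v : M.E × F ↦ φ.symm v.1)
        {v | v.1 ∈ φ.target ∧ (f (φ.symm v.1), v.2) ∈ L.target} :=
      φ.continuousOn_symm.comp continuous_fst.continuousOn fun v hv ↦ hv.1
    have h1 : ContinuousOn (fun v : M.E × F ↦ (f (φ.symm v.1), v.2))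
        {v | v.1 ∈ φ.target ∧ (f (φ.symm v.1), v.2) ∈ L.target} :=
      ((continuous f).comp_continuousOn h0).prodMk continuous_snd.continuousOn
    refine (h0.prodMk (L.contMDiffOn_symm.continuousOn.comp h1 fun v hv ↦ hv.2)).congr
      fun v hv ↦ ?_
    simp only [Function.comp_apply]
    rw [dif_pos (L.fst_symm _ hv.2).symm]

variable (φ : OpenPartialHomeomorph M.carrier M.E) {y : K.carrier}
  (L : LocalProduct F g y) (x₀ : Carrier f g)

theorem chart_symm_apply {v : M.E × F} (hv : v ∈ (chart φ L x₀).target) :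
    ((chart φ L x₀).symm v).1 = (φ.symm v.1, L.symm (f (φ.symm v.1), v.2)) := by
  exact congrArg Subtype.val (dif_pos (L.fst_symm _ hv.2).symm)

variable {φ} (hφ : φ ∈ IsManifold.maximalAtlas 𝓘(ℝ, M.E) ∞ M.carrier)

include hφ

theorem contMDiffOn_chart_symm_fst : ContMDiffOn 𝓘(ℝ, M.E × F) 𝓘(ℝ, M.E) ∞
    (fun v ↦ ((chart φ L x₀).symm v).1.1) (chart φ L x₀).target := by
  refine ContMDiffOn.congr (f := fun v ↦ φ.symm v.1) ?_ fun v hv ↦ by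
    rw [chart_symm_apply φ L x₀ hv]
  exact (contMDiffOn_symm_of_mem_maximalAtlas hφ).comp
    contDiff_fst.contMDiff.contMDiffOn fun v hv ↦ hv.1

theorem contMDiffOn_chart_symm_snd : ContMDiffOn 𝓘(ℝ, M.E × F) 𝓘(ℝ, K.E) ∞
    (fun v ↦ ((chart φ L x₀).symm v).1.2) (chart φ L x₀).target := by
  refine ContMDiffOn.congr (f := fun v ↦ L.symm (f (φ.symm v.1), v.2)) ?_ fun v hv ↦ by
    rw [chart_symm_apply φ L x₀ hv]
  have h0 : ContMDiffOn 𝓘(ℝ, M.E × F) 𝓘(ℝ, M.E) ∞ (fun v : M.E × F ↦ φ.symm v.1)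
      (chart φ L x₀).target :=
    (contMDiffOn_symm_of_mem_maximalAtlas hφ).comp
      contDiff_fst.contMDiff.contMDiffOn fun v hv ↦ hv.1
  exact L.contMDiffOn_symm.comp (((smooth f).comp_contMDiffOn h0).prodMk
    contDiff_snd.contMDiff.contMDiffOn) fun v hv ↦ hv.2

/-- A chart of the fibre product is smooth along any map with smooth components. -/
theorem contMDiffOn_chart_comp {E H : Type*} [NormedAddCommGroup E] [NormedSpace ℝ E]
    [TopologicalSpace H] [ChartedSpace E H] {s : Set H} {h : H → Carrier f g}
    (h₁ : ContMDiffOn 𝓘(ℝ, E) 𝓘(ℝ, M.E) ∞ (fun x ↦ (h x).1.1) s)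
    (h₂ : ContMDiffOn 𝓘(ℝ, E) 𝓘(ℝ, K.E) ∞ (fun x ↦ (h x).1.2) s) :
    ContMDiffOn 𝓘(ℝ, E) 𝓘(ℝ, M.E × F) ∞ (fun x ↦ chart φ L x₀ (h x))
      (s ∩ h ⁻¹' (chart φ L x₀).source) :=
  ContMDiffOn.prodMk_space
    ((contMDiffOn_of_mem_maximalAtlas hφ).comp (h₁.mono Set.inter_subset_left)
      fun _ hx ↦ hx.2.1)
    (L.contMDiffOn_snd.comp (h₂.mono Set.inter_subset_left) fun _ hx ↦ hx.2.2)

end FibreProduct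

open FibreProduct in
/-- Pullbacks of submersions exist. -/
theorem exists_isPullback (f : M ⟶ N) {g : K ⟶ N} (hg : IsSubmersion g) :
    ∃ (P : Diff.{u}) (p : P ⟶ M) (q : P ⟶ K), IsPullback p q f g := by
  -- One complement for all points gives all charts the common model `M.E × F`.
  obtain ⟨F, _, _, _, hF⟩ := hg.exists_complement
  let L : ∀ y, LocalProduct F g y := fun y ↦ (nonempty_localProduct (hF y)).some
  let c : Carrier f g → OpenPartialHomeomorph (Carrier f g) (M.E × F) :=
    fun x ↦ chart (chartAt M.E x.1.1) (L x.1.2) x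
  have hφ (x : M.carrier) : chartAt M.E x ∈ IsManifold.maximalAtlas 𝓘(ℝ, M.E) ∞ M.carrier :=
    IsManifold.chart_mem_maximalAtlas x
  let _ : ChartedSpace (M.E × F) (Carrier f g) :=
    { atlas := Set.range c
      chartAt := c
      mem_chart_source := fun x ↦ ⟨mem_chart_source _ _, (L x.1.2).mem_source⟩
      chart_mem_atlas := fun x ↦ ⟨x, rfl⟩ }
  have hmf : IsManifold 𝓘(ℝ, M.E × F) ∞ (Carrier f g) := by
    apply isManifold_of_contDiffOn
    rintro _ _ ⟨x, rfl⟩ ⟨x', rfl⟩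
    have h := contMDiffOn_chart_comp (L x'.1.2) x' (hφ x'.1.1)
      (contMDiffOn_chart_symm_fst (L x.1.2) x (hφ x.1.1))
      (contMDiffOn_chart_symm_snd (L x.1.2) x (hφ x.1.1))
    rw [contMDiffOn_iff_contDiffOn] at h
    refine h.mono fun v hv ↦ ?_
    simpa using hv
  have hsc : SecondCountableTopology (Carrier f g) :=
    Topology.IsEmbedding.subtypeVal.secondCountableTopology
  let P : Diff.{u} := { carrier := Carrier f g, E := M.E × F }
  -- Smoothness into the fibre product is tested on the two components; this supplies the universal
  -- property.
  have smooth_of {T : Diff.{u}} (h : T.carrier → Carrier f g)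
      (h₁ : ContMDiff 𝓘(ℝ, T.E) 𝓘(ℝ, M.E) ∞ (fun x ↦ (h x).1.1))
      (h₂ : ContMDiff 𝓘(ℝ, T.E) 𝓘(ℝ, K.E) ∞ (fun x ↦ (h x).1.2)) :
      ContMDiff 𝓘(ℝ, T.E) 𝓘(ℝ, M.E × F) ∞ h := by
    have hc : Continuous h := Topology.IsInducing.subtypeVal.continuous_iff.2
      (h₁.continuous.prodMk h₂.continuous)
    intro t
    rw [contMDiffAt_iff_target]
    refine ⟨hc.continuousAt, ?_⟩
    have := contMDiffOn_chart_comp (L (h t).1.2) (h t) (hφ (h t).1.1)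
      (contMDiffOn_univ.2 h₁) (contMDiffOn_univ.2 h₂)
    rw [Set.univ_inter] at this
    exact this.contMDiffAt (((c (h t)).open_source.preimage hc).mem_nhds
      (mem_chart_source (M.E × F) (h t)))
  have hp : ContMDiff 𝓘(ℝ, M.E × F) 𝓘(ℝ, M.E) ∞ (fun x : Carrier f g ↦ x.1.1) := fun x ↦ by
    have h1 := contMDiffOn_chart_symm_fst (L x.1.2) x (hφ x.1.1)
    have h2 : ContMDiffOn 𝓘(ℝ, M.E × F) 𝓘(ℝ, M.E × F) ∞ (c x) (c x).source :=
      contMDiffOn_of_mem_maximalAtlas (IsManifold.chart_mem_maximalAtlas x)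
    refine ((h1.comp h2 (c x).mapsTo).congr fun y hy ↦ ?_).contMDiffAt
      ((c x).open_source.mem_nhds (mem_chart_source (M.E × F) x))
    exact congrArg (fun z : Carrier f g ↦ z.1.1) ((c x).left_inv hy).symm
  have hq : ContMDiff 𝓘(ℝ, M.E × F) 𝓘(ℝ, K.E) ∞ (fun x : Carrier f g ↦ x.1.2) := fun x ↦ by
    have h1 := contMDiffOn_chart_symm_snd (L x.1.2) x (hφ x.1.1)
    have h2 : ContMDiffOn 𝓘(ℝ, M.E × F) 𝓘(ℝ, M.E × F) ∞ (c x) (c x).source :=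
      contMDiffOn_of_mem_maximalAtlas (IsManifold.chart_mem_maximalAtlas x)
    refine ((h1.comp h2 (c x).mapsTo).congr fun y hy ↦ ?_).contMDiffAt
      ((c x).open_source.mem_nhds (mem_chart_source (M.E × F) x))
    exact congrArg (fun z : Carrier f g ↦ z.1.2) ((c x).left_inv hy).symm
  let p : P ⟶ M := homMk (M := P) (fun x : Carrier f g ↦ x.1.1) hp
  let q : P ⟶ K := homMk (M := P) (fun x : Carrier f g ↦ x.1.2) hq
  refine ⟨P, p, q, ⟨hom_ext fun x ↦ Subtype.property (p := fun y : M.carrier × K.carrier ↦ f y.1 = g y.2) x⟩,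
    ⟨PullbackCone.IsLimit.mk _ (fun s ↦ homMk (N := P)
      (fun x ↦ (⟨(s.fst x, s.snd x), congr_apply s.condition x⟩ : Carrier f g))
      (smooth_of _ (smooth s.fst) (smooth s.snd))) (fun s ↦ rfl) (fun s ↦ rfl)
      fun s m h₁ h₂ ↦ hom_ext fun x ↦ ?_⟩⟩
  exact Subtype.ext (Prod.ext (congr_apply h₁ x) (congr_apply h₂ x))

section Pullback

variable {P : Diff.{u}} {p : P ⟶ M} {q : P ⟶ K} {f : M ⟶ N} {g : K ⟶ N}

theorem ext_of_isPullback (h : IsPullback p q f g) {z z' : P.carrier} (e : p z = p z')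
    (e' : q z = q z') : z = z' := by
  have : (const z : pt ⟶ P) = const z' := h.hom_ext
    (by rw [const_comp, const_comp, e]) (by rw [const_comp, const_comp, e'])
  exact congr_apply this default

/-- A local section of `g` through `q z` induces, by the universal property, a local section of `p`
through `z`. -/
theorem submAt_of_isPullback (h : IsPullback p q f g) {z : P.carrier} (hg : SubmAt g (q z)) :
    SubmAt p z := by
  obtain ⟨V, σ, hV, hσ, hσg⟩ := hg.exists_section
  let U : TopologicalSpace.Opens M.carrier := ⟨f ⁻¹' V, V.isOpen.preimage (continuous f)⟩
  let r : openSub M U ⟶ openSub N V := openLift V (ι U ≫ f) fun x ↦ ι_mem U x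
  have w : ι U ≫ f = (r ≫ σ) ≫ g := by
    rw [Category.assoc, hσg]; rfl
  have hz : f (p z) ∈ V := by rw [← comp_apply, h.w]; exact hV
  let z' : (openSub M U).carrier := (⟨p z, hz⟩ : U)
  have hl : h.lift (ι U) (r ≫ σ) w z' = z := by
    apply ext_of_isPullback h
    · exact congr_apply (h.lift_fst _ _ w) z'
    · refine (congr_apply (h.lift_snd _ _ w) z').trans (hσ _ ?_)
      exact congr_apply h.w z
  have hs : SubmAt (h.lift (ι U) (r ≫ σ) w ≫ p) z' := by
    rw [h.lift_fst]
    exact submAt_ι U z'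
  rw [← hl]
  exact hs.of_comp

theorem isSubmersion_of_isPullback (h : IsPullback p q f g) (hg : IsSubmersion g) :
    IsSubmersion p :=
  isSubmersion_iff.2 fun _ ↦ submAt_of_isPullback h (isSubmersion_iff.1 hg _)

theorem isSubmersion_comp {f : M ⟶ N} {g : N ⟶ K} (hf : IsSubmersion f) (hg : IsSubmersion g) :
    IsSubmersion (f ≫ g) :=
  isSubmersion_iff.2 fun _ ↦ (isSubmersion_iff.1 hf _).comp (isSubmersion_iff.1 hg _)

theorem isSubmersion_ι (U : TopologicalSpace.Opens M.carrier) : IsSubmersion (ι U) :=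
  isSubmersion_iff.2 (submAt_ι U)

end Pullback

end Diff

/-! ### Smooth one-sided inverses near an invertible arrow -/

namespace Diff

variable {M N K T : Diff.{u}}

section Prod

theorem deriv_prodFst (x : (prodObj M N).carrier) :
    deriv (prodFst M N) x = ContinuousLinearMap.fst ℝ M.E N.E := by
  have h := hasMFDerivAt_fst (I := 𝓘(ℝ, M.E)) (I' := 𝓘(ℝ, N.E)) (M := M.carrier) (M' := N.carrier) x
  rw [← modelWithCornersSelf_prod] at h
  exact HasMFDerivAt.mfderiv h

theorem deriv_prodSnd (x : (prodObj M N).carrier) :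
    deriv (prodSnd M N) x = ContinuousLinearMap.snd ℝ M.E N.E := by
  have h := hasMFDerivAt_snd (I := 𝓘(ℝ, M.E)) (I' := 𝓘(ℝ, N.E)) (M := M.carrier) (M' := N.carrier) x
  rw [← modelWithCornersSelf_prod] at h
  exact HasMFDerivAt.mfderiv h

/-- A map to a product is submersive at a point if its first component is submersive along some map,
and its second component is submersive along some map on which the first component is constant. -/
theorem submAt_prodLift {P A B : Diff.{u}} (a : P ⟶ M) (c : P ⟶ N) (α : A ⟶ P) (β : B ⟶ P)
    (a₀ : A.carrier) (b₀ : B.carrier) (h : α a₀ = β b₀) (hα : SubmAt (α ≫ a) a₀) (m : M.carrier)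
    (hβ : β ≫ a = const m) (hβ' : SubmAt (β ≫ c) b₀) : SubmAt (prodLift a c) (α a₀) := by
  have h1 (v) : (deriv (prodLift a c) (α a₀) v : M.E × N.E).1 = deriv a (α a₀) v := by
    conv_rhs => rw [← prodLift_fst a c, deriv_comp, deriv_prodFst]
    rfl
  have h2 (v) : (deriv (prodLift a c) (α a₀) v : M.E × N.E).2 = deriv c (α a₀) v := by
    conv_rhs => rw [← prodLift_snd a c, deriv_comp, deriv_prodSnd]
    rfl
  rintro ⟨w₁, w₂⟩
  obtain ⟨v₁, hv₁⟩ := hα w₁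
  rw [deriv_comp] at hv₁
  -- The second component is corrected along `β`, which leaves the first unchanged.
  obtain ⟨v₂, hv₂⟩ := hβ' (w₂ - deriv c (α a₀) (deriv α a₀ v₁))
  rw [deriv_comp, ← h] at hv₂
  have h3 : deriv a (α a₀) (deriv β b₀ v₂) = 0 := by
    have : deriv (β ≫ a) b₀ v₂ = 0 := by rw [hβ, deriv_const]; rfl
    rwa [deriv_comp, ← h] at this
  refine ⟨deriv α a₀ v₁ + deriv β b₀ v₂, Prod.ext ?_ ?_⟩
  · rw [h1, map_add, h3, add_zero]
    exact hv₁
  · rw [h2, map_add]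
    exact (congrArg _ hv₂).trans (add_sub_cancel _ _)

end Prod

/-- A submersion has vertical coordinates near each point: a map to a manifold `G` which is
injective on fibres, together with a family of points of the fibre on which it is submersive. -/
theorem SubmAt.exists_vertical {f : M ⟶ N} {x : M.carrier} (h : SubmAt f x) :
    ∃ (O : TopologicalSpace.Opens M.carrier) (G B : Diff.{u}) (κ : openSub M O ⟶ G)
      (k : B ⟶ openSub M O) (b : B.carrier), x ∈ O ∧ ι O (k b) = x ∧
      k ≫ ι O ≫ f = const (f x) ∧ SubmAt (k ≫ κ) b ∧
      ∀ y z, f (ι O y) = f (ι O z) → κ y = κ z → y = z := by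
  obtain ⟨n, hn⟩ := h.exists_finrank_eq
  obtain ⟨L⟩ := nonempty_localProduct (h.isSubmersionAtOfComplement hn)
  let F := EuclideanSpace ℝ (Fin n)
  let U : TopologicalSpace.Opens (vec.{u} F).carrier :=
    ⟨(fun v ↦ (f x, vecDown v)) ⁻¹' L.target, L.isOpen_target.preimage
      (continuous_const.prodMk (contMDiff_vecDown F).continuous)⟩
  have hκ : ContMDiffOn 𝓘(ℝ, M.E) 𝓘(ℝ, (vec.{u} F).E) ∞ (fun y ↦ (vecUp (L.snd y) :
      (vec.{u} F).carrier)) L.source :=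
    (contMDiff_vecUp F).comp_contMDiffOn L.contMDiffOn_snd
  have hk : ContMDiffOn 𝓘(ℝ, (vec.{u} F).E) 𝓘(ℝ, M.E) ∞ (fun v : (vec.{u} F).carrier ↦
      L.symm (f x, vecDown v)) U :=
    L.contMDiffOn_symm.comp (contMDiffOn_const.prodMk (contMDiff_vecDown F).contMDiffOn)
      fun v hv ↦ hv
  let κ := ofContMDiffOn L.source _ hκ
  let k := openLift L.source (ofContMDiffOn U _ hk) fun v ↦ L.map_target _ (ι_mem U v)
  have hb : vecUp (L.snd x) ∈ U := L.map_source x L.mem_source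
  have hkκ : k ≫ κ = ι U := hom_ext fun v ↦ by
    have := L.snd_symm _ (ι_mem U v)
    exact congrArg vecUp this
  refine ⟨L.source, vec F, openSub (vec F) U, κ, k, ⟨vecUp (L.snd x), hb⟩, L.mem_source,
    L.left_inv x L.mem_source, hom_ext fun v ↦ L.fst_symm _ (ι_mem U v), ?_, fun y z h₁ h₂ ↦ ?_⟩
  · rw [hkκ]
    exact submAt_ι U _
  · apply ι_injective
    have h₃ : L.snd (ι _ y) = L.snd (ι _ z) := congrArg vecDown h₂
    rw [← L.left_inv _ (ι_mem _ y), ← L.left_inv _ (ι_mem _ z), h₁, h₃]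

section Inverses

variable (X : InternalCategory Diff.{u})

/-- Near an invertible arrow, arrows have right inverses, smoothly. -/
theorem exists_right_inverse (hs : ∀ x, SubmAt X.src x) {g h : pt ⟶ X.arr}
    (H : X.AreInverse g h) :
    ∃ (R : Diff.{u}) (ρ r : R ⟶ X.arr) (w : ρ ≫ X.tgt = r ≫ X.src) (z : R.carrier),
      IsSubmersion ρ ∧ X.comp ρ r w = ρ ≫ X.src ≫ X.unit ∧ ρ z = g default := by
  obtain ⟨g₀, rfl⟩ : ∃ g₀, g = const g₀ := ⟨_, eq_const g⟩
  obtain ⟨h₀, rfl⟩ : ∃ h₀, h = const h₀ := ⟨_, eq_const h⟩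
  obtain ⟨w, w', e, -⟩ := H
  have w₀ : X.tgt g₀ = X.src h₀ := congr_apply w default
  have w₀' : X.tgt h₀ = X.src g₀ := congr_apply w' default
  -- The unit `u₀` equals `g₀ h₀`; `κ` below measures arrows near it along the fibres of the source
  -- map.
  let u₀ := X.unit (X.src g₀)
  have hu₀ : X.src u₀ = X.src g₀ := congr_apply X.unit_src _
  obtain ⟨O, G, B, κ, k, b, hO, hkb, hkf, hkκ, hκ⟩ := (hs u₀).exists_vertical
  obtain ⟨V, σ, hV, hσ, hσs⟩ := (hs h₀).exists_section
  obtain ⟨p₀, hp₀, hp₀'⟩ := exists_point_of_isPullback X.isPullback_pairs w₀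
  have hmul : X.mul p₀ = u₀ := by
    have h1 := congr_apply e default
    refine Eq.trans ?_ h1
    refine congrArg X.mul (ext_of_isPullback X.isPullback_pairs ?_ ?_)
    · exact hp₀.trans (congr_apply (X.isPullback_pairs.lift_fst _ _ w) default).symm
    · exact hp₀'.trans (congr_apply (X.isPullback_pairs.lift_snd _ _ w) default).symm
  let Q : TopologicalSpace.Opens X.pairs.carrier :=
    ⟨X.mul ⁻¹' O, O.isOpen.preimage (continuous X.mul)⟩
  let m : openSub X.pairs Q ⟶ openSub X.arr O := openLift O (ι Q ≫ X.mul) (ι_mem Q)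
  -- `Ψ (g, h) = (g, κ (g h))`. Once it is submersive, `g h = 1` can be imposed by a pullback.
  let Ψ : openSub X.pairs Q ⟶ prodObj X.arr G := prodLift (ι Q ≫ X.fst) (m ≫ κ)
  have hp₀Q : p₀ ∈ Q := by
    change X.mul p₀ ∈ O
    rwa [hmul]
  let d₀ : (openSub X.pairs Q).carrier := (⟨p₀, hp₀Q⟩ : Q)
  -- Two families through `(g₀, h₀)` span the tangent directions of the product: `g ↦ (g, σ (tgt
  -- g))`, on which the first component is an inclusion, and `v ↦ (g₀, h₀ k(v))`, on which it is
  -- constant while the product is `k(v)`, because `g₀ h₀ = 1`.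
  have hΨ : SubmAt Ψ d₀ := by
    -- the first family of composable pairs
    let V' : TopologicalSpace.Opens X.arr.carrier :=
      ⟨X.tgt ⁻¹' V, V.isOpen.preimage (continuous X.tgt)⟩
    let r : openSub X.arr V' ⟶ openSub X.obj V := openLift V (ι V' ≫ X.tgt) (ι_mem V')
    have wα : ι V' ≫ X.tgt = (r ≫ σ) ≫ X.src := by
      rw [Category.assoc, hσs]; rfl
    let α := X.isPullback_pairs.lift _ _ wα
    let Q' : TopologicalSpace.Opens (openSub X.arr V').carrier :=
      ⟨α ⁻¹' Q, Q.isOpen.preimage (continuous α)⟩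
    let α' : openSub _ Q' ⟶ openSub X.pairs Q := openLift Q (ι Q' ≫ α) (ι_mem Q')
    have hg₀ : g₀ ∈ V' := by
      change X.tgt g₀ ∈ V
      rwa [w₀]
    let g₁ : (openSub X.arr V').carrier := (⟨g₀, hg₀⟩ : V')
    have hα : α g₁ = p₀ := by
      apply ext_of_isPullback X.isPullback_pairs
      · exact (congr_apply (X.isPullback_pairs.lift_fst _ _ wα) g₁).trans hp₀.symm
      · exact ((congr_apply (X.isPullback_pairs.lift_snd _ _ wα) g₁).trans (hσ _ w₀)).trans
          hp₀'.symm
    have hg₁ : g₁ ∈ Q' := by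
      change α g₁ ∈ Q
      rwa [hα]
    let g₂ : (openSub (openSub X.arr V') Q').carrier := (⟨g₁, hg₁⟩ : Q')
    have hα' : α' g₂ = d₀ := ι_injective Q hα
    -- the second family of composable pairs
    have w1 : (const h₀ : B ⟶ X.arr) ≫ X.tgt = (k ≫ ι O) ≫ X.src := by
      rw [Category.assoc, hkf, const_comp, w₀', hu₀]
    have wg : (const g₀ : B ⟶ X.arr) ≫ X.tgt = (const h₀ : B ⟶ X.arr) ≫ X.src := by
      rw [const_comp, const_comp, w₀]
    have wβ : (const g₀ : B ⟶ X.arr) ≫ X.tgt =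
        X.comp (const h₀ : B ⟶ X.arr) (k ≫ ι O) w1 ≫ X.src := by
      rw [InternalCategory.comp_src, wg]
    let β := X.isPullback_pairs.lift _ _ wβ
    have hβm : β ≫ X.mul = k ≫ ι O := by
      change X.comp (const g₀) (X.comp (const h₀) (k ≫ ι O) w1) wβ = _
      rw [← X.comp_assoc _ _ _ wg]
      have e' := congrArg (fun l ↦ (const default : B ⟶ pt) ≫ l) e
      simp only [InternalCategoryData.precomp_comp] at e'
      refine (InternalCategoryData.comp_congr _ (g' := (const (X.src g₀) : B ⟶ X.obj) ≫ X.unit)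
        (h' := k ≫ ι O) e' rfl).trans (X.unit_comp _ _ ?_)
      rw [Category.assoc, hkf, hu₀]
    let β' : B ⟶ openSub X.pairs Q := openLift Q β fun v ↦ by
      change X.mul (β v) ∈ O
      rw [← comp_apply, hβm]
      exact ι_mem O (k v)
    have hβ : β b = p₀ := by
      apply ext_of_isPullback X.isPullback_pairs
      · exact (congr_apply (X.isPullback_pairs.lift_fst _ _ wβ) b).trans hp₀.symm
      · refine ((congr_apply (X.isPullback_pairs.lift_snd _ _ wβ) b).trans ?_).trans hp₀'.symm
        have h1 : (const b : pt ⟶ B) ≫ X.comp (const h₀ : B ⟶ X.arr) (k ≫ ι O) w1 =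
            const h₀ := by
          rw [InternalCategoryData.precomp_comp]
          refine (InternalCategoryData.comp_congr _ (g' := const h₀)
            (h' := (const (X.src g₀) : pt ⟶ X.obj) ≫ X.unit) rfl ?_).trans (X.comp_unit _ _ ?_)
          · exact congrArg const hkb
          · rw [const_comp, w₀']
        exact congr_apply h1 default
    have hβ' : β' b = d₀ := ι_injective Q hβ
    have hβκ : β' ≫ m ≫ κ = k ≫ κ := by
      rw [← Category.assoc]
      congr 1
      exact hom_ext fun v ↦ ι_injective O (congr_apply hβm v)
    rw [← hα']
    refine submAt_prodLift (ι Q ≫ X.fst) (m ≫ κ) α' β' g₂ b (hα'.trans hβ'.symm) ?_ g₀ ?_ ?_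
    · have : α' ≫ ι Q ≫ X.fst = ι Q' ≫ ι V' := by
        rw [← Category.assoc, openLift_ι, Category.assoc, X.isPullback_pairs.lift_fst]
      rw [this]
      exact (submAt_ι Q' g₂).comp (submAt_ι V' _)
    · rw [← Category.assoc, openLift_ι, X.isPullback_pairs.lift_fst]
    · rwa [hβκ]
  let W : TopologicalSpace.Opens (openSub X.pairs Q).carrier := ⟨_, isOpen_submAt Ψ⟩
  have hΨ' : IsSubmersion (ι W ≫ Ψ) := isSubmersion_iff.2 fun x ↦
    (submAt_ι W x).comp (ι_mem W x)
  let A : TopologicalSpace.Opens X.arr.carrier :=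
    ⟨(X.src ≫ X.unit) ⁻¹' O, O.isOpen.preimage (continuous _)⟩
  -- Pulling `Ψ` back along `g ↦ (g, κ (1_{src g}))` imposes `κ (g h) = κ (1_{src g})`.
  let n : openSub X.arr A ⟶ openSub X.arr O := openLift O (ι A ≫ X.src ≫ X.unit) (ι_mem A)
  obtain ⟨R, p, q, hR⟩ := exists_isPullback (prodLift (ι A) (n ≫ κ)) hΨ'
  have hfst : p ≫ ι A = q ≫ ι W ≫ ι Q ≫ X.fst := hR.w =≫ prodFst X.arr G
  have hsnd : p ≫ n ≫ κ = q ≫ ι W ≫ m ≫ κ := hR.w =≫ prodSnd X.arr G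
  have wρ : (p ≫ ι A) ≫ X.tgt = (q ≫ ι W ≫ ι Q ≫ X.snd) ≫ X.src := by
    rw [hfst]
    simp only [Category.assoc, X.isPullback_pairs.w]
  -- `g h` and `1_{src g}` have the same source and the same vertical coordinate, hence coincide.
  have hmn : q ≫ ι W ≫ m = p ≫ n := hom_ext fun z ↦ by
    refine hκ _ _ ?_ (congr_apply hsnd z).symm
    have h1 : (q ≫ ι W ≫ m) ≫ ι O ≫ X.src = (p ≫ n) ≫ ι O ≫ X.src := by
      have h2 : m ≫ ι O = ι Q ≫ X.mul := rfl
      have h3 : n ≫ ι O = ι A ≫ X.src ≫ X.unit := rfl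
      simp only [Category.assoc, reassoc_of% h2, reassoc_of% h3, X.mul_src, X.unit_src,
        Category.comp_id, reassoc_of% hfst]
    exact congr_apply h1 z
  have hg₀A : g₀ ∈ A := hO
  obtain ⟨z, hz, -⟩ := exists_point_of_isPullback hR
    (x := (⟨g₀, hg₀A⟩ : A)) (y := (⟨d₀, hΨ⟩ : W)) (by
      refine Prod.ext hp₀.symm (congrArg κ (ι_injective O ?_))
      exact hmul.symm)
  refine ⟨R, p ≫ ι A, q ≫ ι W ≫ ι Q ≫ X.snd, wρ, z,
    isSubmersion_comp (isSubmersion_of_isPullback hR hΨ') (isSubmersion_ι A), ?_, ?_⟩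
  · have h1 : X.isPullback_pairs.lift _ _ wρ = q ≫ ι W ≫ ι Q := by
      apply X.isPullback_pairs.hom_ext
      · rw [X.isPullback_pairs.lift_fst, hfst]; simp only [Category.assoc]
      · rw [X.isPullback_pairs.lift_snd]; simp only [Category.assoc]
    rw [InternalCategoryData.comp, h1]
    exact hmn =≫ ι O
  · exact congrArg (ι A) hz

end Inverses

end Diff

/-! ### The open submanifold of invertible arrows -/

namespace Diff

section Isos

variable (X : InternalCategory Diff.{u})

/-- Near an invertible arrow, arrows have left inverses, smoothly. -/
theorem exists_left_inverse (ht : ∀ x, SubmAt X.tgt x) {g h : pt ⟶ X.arr}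
    (H : X.AreInverse g h) :
    ∃ (L : Diff.{u}) (ρ l : L ⟶ X.arr) (w : l ≫ X.tgt = ρ ≫ X.src) (z : L.carrier),
      IsSubmersion ρ ∧ X.comp l ρ w = ρ ≫ X.tgt ≫ X.unit ∧ ρ z = g default := by
  obtain ⟨L, ρ, l, w, b, hρ, e, hb⟩ := exists_right_inverse X.op ht H.op
  exact ⟨L, ρ, l, w.symm, b, hρ, (X.op_comp ρ l w).symm.trans e, hb⟩

/-- Near an invertible arrow, arrows are invertible, smoothly. -/
theorem exists_submersion_areInverse (hs : IsSubmersion X.src) (ht : IsSubmersion X.tgt)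
    {g h : pt ⟶ X.arr} (H : X.AreInverse g h) :
    ∃ (Z : Diff.{u}) (d r : Z ⟶ X.arr) (z : Z.carrier),
      IsSubmersion d ∧ X.AreInverse d r ∧ d z = g default := by
  obtain ⟨R, ρ, r, w, a, hρ, e, ha⟩ := exists_right_inverse X hs.submAt H
  obtain ⟨L, ρ', l, w', b, hρ', e', hb⟩ := exists_left_inverse X ht.submAt H
  -- Over `Z` the same arrow has both a right and a left inverse, so it is invertible.
  obtain ⟨Z, p, q, hZ⟩ := exists_isPullback ρ hρ'
  obtain ⟨z, hz, -⟩ := exists_point_of_isPullback hZ (ha.trans hb.symm)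
  refine ⟨Z, p ≫ ρ, p ≫ r, z, isSubmersion_comp (isSubmersion_of_isPullback hZ hρ') hρ, ?_,
    (congrArg ρ hz).trans ha⟩
  have e₂ := congrArg (fun k ↦ p ≫ k) e
  have e₃ := congrArg (fun k ↦ q ≫ k) e'
  simp only [InternalCategoryData.precomp_comp] at e₂ e₃
  have hw : p ≫ ρ = q ≫ ρ' := hZ.w
  refine InternalCategory.areInverse_of_left_of_right (p ≫ ρ) (q ≫ l) (p ≫ r) ?_ ?_ ?_ ?_
  · rw [hw, Category.assoc, Category.assoc, w']
  · rw [Category.assoc, Category.assoc, w]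
  · rw [InternalCategoryData.comp_congr _ rfl hw, e₃, hw, Category.assoc]
  · rw [e₂, Category.assoc]

/-- The points which are invertible arrows. -/
def isoPoints : Set X.arr.carrier := {y | ∃ h : pt ⟶ X.arr, X.AreInverse (const y) h}

/-- A local section of the submersion `d` turns inverses over `Z` into inverses over an open set of
arrows. -/
theorem exists_local_inverse (hs : IsSubmersion X.src) (ht : IsSubmersion X.tgt)
    {y : X.arr.carrier} (hy : y ∈ isoPoints X) :
    ∃ (V : TopologicalSpace.Opens X.arr.carrier) (r : openSub X.arr V ⟶ X.arr),
      y ∈ V ∧ X.AreInverse (ι V) r := by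
  obtain ⟨h, H⟩ := hy
  obtain ⟨Z, d, r, z, hd, hr, hz⟩ := exists_submersion_areInverse X hs ht H
  obtain ⟨V, σ, hV, -, hσ⟩ := (hd.submAt z).exists_section
  refine ⟨V, σ ≫ r, ?_, ?_⟩
  · rw [hz] at hV
    exact hV
  · rw [← hσ]
    exact hr.precomp σ

theorem mem_isoPoints {T : Diff.{u}} {g h : T ⟶ X.arr} (H : X.AreInverse g h) (x : T.carrier) :
    g x ∈ isoPoints X :=
  ⟨_, H.precomp (const x)⟩

theorem isOpen_isoPoints (hs : IsSubmersion X.src) (ht : IsSubmersion X.tgt) :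
    IsOpen (isoPoints X) := by
  refine isOpen_iff_forall_mem_open.2 fun y hy ↦ ?_
  obtain ⟨V, r, hV, hr⟩ := exists_local_inverse X hs ht hy
  exact ⟨V, fun x hx ↦ mem_isoPoints X hr (⟨x, hx⟩ : V), V.isOpen, hV⟩

theorem areInverse_of_forall {T : Diff.{u}} {g h : T ⟶ X.arr}
    (H : ∀ x, X.AreInverse (const (g x) : pt ⟶ X.arr) (const (h x))) : X.AreInverse g h := by
  have w : g ≫ X.tgt = h ≫ X.src := hom_ext fun x ↦ congr_apply (H x).choose default
  have w' : h ≫ X.tgt = g ≫ X.src := hom_ext fun x ↦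
    congr_apply (H x).choose_spec.choose default
  refine ⟨w, w', hom_ext fun x ↦ ?_, hom_ext fun x ↦ ?_⟩
  · obtain ⟨v, v', e, -⟩ := H x
    refine (congr_apply (X.precomp_comp (const x : pt ⟶ T) g h w) default).trans ?_
    exact congr_apply e default
  · obtain ⟨v, v', -, e⟩ := H x
    refine (congr_apply (X.precomp_comp (const x : pt ⟶ T) h g w') default).trans ?_
    exact congr_apply e default

open Classical in
/-- The inverse of an invertible arrow. -/
noncomputable def invPoint (y : X.arr.carrier) : X.arr.carrier :=
  if hy : y ∈ isoPoints X then hy.choose default else y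

theorem areInverse_invPoint {y : X.arr.carrier} (hy : y ∈ isoPoints X) :
    X.AreInverse (const y : pt ⟶ X.arr) (const (invPoint X y)) := by
  rw [invPoint, dif_pos hy, ← eq_const]
  exact hy.choose_spec

theorem invPoint_eq {T : Diff.{u}} {g h : T ⟶ X.arr} (H : X.AreInverse g h) (x : T.carrier) :
    invPoint X (g x) = h x :=
  congr_apply ((areInverse_invPoint X (mem_isoPoints X H x)).unique (H.precomp (const x))) default

/-- By uniqueness of inverses, the pointwise choice agrees with the smooth local inverses. -/
theorem contMDiffOn_invPoint (hs : IsSubmersion X.src) (ht : IsSubmersion X.tgt) :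
    ContMDiffOn 𝓘(ℝ, X.arr.E) 𝓘(ℝ, X.arr.E) ∞ (invPoint X) (isoPoints X) := by
  intro y hy
  obtain ⟨V, r, hV, hr⟩ := exists_local_inverse X hs ht hy
  have h₁ : ContMDiff 𝓘(ℝ, X.arr.E) 𝓘(ℝ, X.arr.E) ∞ (fun x : V ↦ invPoint X x) := by
    have h₂ : (fun x : V ↦ invPoint X x) = Hom.toFun r := funext fun x ↦ invPoint_eq X hr x
    rw [h₂]
    exact smooth r
  exact (contMDiffAt_subtype_iff.1 (h₁ ⟨y, hV⟩)).contMDiffWithinAt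

/-- In a category internal to manifolds with submersive source and target, the object of
invertible arrows is an open submanifold of the manifold of arrows. -/
theorem exists_isObjectOfIsos (hs : IsSubmersion X.src) (ht : IsSubmersion X.tgt) :
    ∃ (U : TopologicalSpace.Opens X.arr.carrier) (inv : openSub X.arr U ⟶ X.arr),
      X.IsObjectOfIsos (ι U) inv := by
  let U : TopologicalSpace.Opens X.arr.carrier := ⟨isoPoints X, isOpen_isoPoints X hs ht⟩
  have H : X.AreInverse (ι U) (ofContMDiffOn U (invPoint X) (contMDiffOn_invPoint X hs ht)) :=
    areInverse_of_forall X fun x ↦ areInverse_invPoint X (ι_mem U x)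
  refine ⟨U, _, H, fun g h K ↦ ⟨openLift U g (mem_isoPoints X K), ⟨rfl, ?_⟩, fun k hk ↦ ?_⟩⟩
  · exact (H.precomp (openLift U g (mem_isoPoints X K))).unique K
  · exact hom_ext fun x ↦ ι_injective U (congr_apply hk.1 x)

end Isos

end Diff

/-! ### Comparing the two notions -/

section Surjectivity

variable {S : Type u} [Category.{v} S] [HasBinaryProducts S] {X Y B : InternalCategory S}

/-- Splits the pullback along a product map into two successive ones, along the source map and along
`j`; both exist when these are submersions. -/
theorem IsArrowPullback.of_isPullback {U A B : S} {j : U ⟶ Y.obj} {a : A ⟶ U} {y : A ⟶ Y.arr}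
    (hA : IsPullback a y j Y.src) {b : B ⟶ A} {t : B ⟶ U} (hB : IsPullback b t (y ≫ Y.tgt) j) :
    IsArrowPullback Y j (b ≫ a) t (b ≫ y) := by
  refine IsPullback.of_isLimit' ⟨?_⟩ (PullbackCone.IsLimit.mk _
    (fun s ↦ hB.lift (hA.lift (s.fst ≫ prod.fst) s.snd ?_) (s.fst ≫ prod.snd) ?_) ?_ ?_ ?_)
  · apply Limits.prod.hom_ext
    · simp [hA.w, prod.lift_fst]
    · simp [hB.w, prod.lift_snd]
  · have h := s.condition =≫ prod.fst
    simpa [prod.lift_fst] using h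
  · have h := s.condition =≫ prod.snd
    simpa [prod.lift_snd] using h.symm
  · intro s
    apply Limits.prod.hom_ext <;> simp [prod.lift_fst, prod.lift_snd]
  · intro s
    simp
  · intro s m h₁ h₂
    apply hB.hom_ext
    · apply hA.hom_ext
      · simp [← h₁, prod.lift_fst]
      · simp [← h₂]
    · simp [← h₁, prod.lift_snd]

/-- If `f` is fully faithful and `u` factors as `f'` followed by `f` up to isomorphism, then there is
a map over `u₀` from the pullback of the target map `X₁^iso ⟶ X₀` along `f'₀` to `X₀ ×_{Y₀} Y₁^iso`,
and generalised elements of `X₀ ×_{Y₀} Y₁^iso` whose target factors through `u₀` lift along it. -/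
theorem InternalFunctor.FullyFaithful.exists_comparison {f : InternalFunctor X Y}
    (hf : f.FullyFaithful) {u : InternalFunctor B Y} {f' : InternalFunctor B X}
    (θ : InternalNatIso u (f'.comp f)) {I I' P W : S} {i inv : I ⟶ Y.arr}
    (hI : Y.IsObjectOfIsos i inv) {i' inv' : I' ⟶ X.arr} (hI' : X.IsObjectOfIsos i' inv')
    {p : P ⟶ X.obj} {q : P ⟶ I} (hP : IsPullback p q f.obj (i ≫ Y.src))
    {c : W ⟶ B.obj} {b : W ⟶ I'} (hW : IsPullback c b f'.obj (i' ≫ X.tgt)) :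
    ∃ κ : W ⟶ P, κ ≫ q ≫ i ≫ Y.tgt = c ≫ u.obj ∧
      ∀ {T : S} (z : T ⟶ P) (x : T ⟶ B.obj), z ≫ q ≫ i ≫ Y.tgt = x ≫ u.obj →
        ∃ w : T ⟶ W, w ≫ κ = z := by
  have hθ : Y.AreInverse θ.hom.app θ.inv.app := by
    refine ⟨θ.hom.app_tgt.trans θ.inv.app_src.symm, θ.inv.app_tgt.trans θ.hom.app_src.symm, ?_, ?_⟩
    · rw [θ.hom_inv, ← Category.assoc, θ.hom.app_src]
    · rw [θ.inv_hom, ← Category.assoc, θ.inv.app_src]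
  have hθt : θ.hom.app ≫ Y.tgt = f'.obj ≫ f.obj := θ.hom.app_tgt
  have hθs : θ.inv.app ≫ Y.src = f'.obj ≫ f.obj := θ.inv.app_src
  -- `κ` sends an isomorphism `x ≅ f' b` of `X` to its image under `f` followed by the inverse of
  -- `θ` at `b`.
  have w₀ : ((b ≫ i') ≫ f.arr) ≫ Y.tgt = (c ≫ θ.inv.app) ≫ Y.src := by
    simp only [Category.assoc, f.arr_tgt, hθs, reassoc_of% hW.w]
  have h₀ := (f.map_areInverse (hI'.areInverse.precomp b)).comp (hθ.symm.precomp c) w₀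
  obtain ⟨k, ⟨hk, -⟩, -⟩ := hI.existsUnique _ _ h₀
  have wκ : (b ≫ i' ≫ X.src) ≫ f.obj = k ≫ i ≫ Y.src := by
    rw [reassoc_of% hk, InternalCategory.comp_src]
    simp only [Category.assoc, f.arr_src]
  refine ⟨hP.lift _ _ wκ, ?_, fun {T} z x hx ↦ ?_⟩
  · rw [hP.lift_snd_assoc, reassoc_of% hk, InternalCategory.comp_tgt, Category.assoc,
      θ.inv.app_tgt]
  -- An isomorphism `f x₀ ≅ u b` followed by `θ` ends at `f (f' b)`, so it lifts to an isomorphism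
  -- of `X`; this lift is the preimage.
  · have w₁ : ((z ≫ q) ≫ i) ≫ Y.tgt = (x ≫ θ.hom.app) ≫ Y.src := by
      simp only [Category.assoc, θ.hom.app_src, hx]
    have h₁ := (hI.areInverse.precomp (z ≫ q)).comp (hθ.precomp x) w₁
    have es : Y.comp ((z ≫ q) ≫ i) (x ≫ θ.hom.app) w₁ ≫ Y.src = (z ≫ p) ≫ f.obj := by
      simp only [InternalCategory.comp_src, Category.assoc, hP.w]
    have et : Y.comp ((z ≫ q) ≫ i) (x ≫ θ.hom.app) w₁ ≫ Y.tgt = (x ≫ f'.obj) ≫ f.obj := by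
      simp only [InternalCategory.comp_tgt, Category.assoc, hθt]
    obtain ⟨d, ds, dt, hd⟩ := hf.exists_lift _ _ _ es et
    obtain ⟨d', ds', dt', hd'⟩ := hf.exists_lift _ _ _ (h₁.choose.symm.trans et)
      (h₁.choose_spec.choose.trans es)
    have hdd' : X.AreInverse d d' := hf.areInverse (dt.trans ds'.symm) (dt'.trans ds.symm) (by
      rw [hd, hd']; exact h₁)
    obtain ⟨l, ⟨hl, -⟩, -⟩ := hI'.existsUnique _ _ hdd'
    have wl : x ≫ f'.obj = l ≫ i' ≫ X.tgt := by rw [reassoc_of% hl, dt]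
    refine ⟨hW.lift x l wl, hP.hom_ext ?_ ?_⟩
    · rw [Category.assoc, hP.lift_fst, hW.lift_snd_assoc, reassoc_of% hl, ds]
    · have hm : hW.lift x l wl ≫ hP.lift _ _ wκ ≫ q ≫ i = z ≫ q ≫ i := by
        rw [hP.lift_snd_assoc, hk, InternalCategoryData.precomp_comp,
          InternalCategoryData.comp_congr _
            (g' := Y.comp ((z ≫ q) ≫ i) (x ≫ θ.hom.app) w₁) (h' := x ≫ θ.inv.app)
            (by rw [Category.assoc, hW.lift_snd_assoc, reassoc_of% hl, hd])
            (by rw [hW.lift_fst_assoc]),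
          InternalCategory.comp_assoc _ _ _ _ _ (by simp only [Category.assoc, hθ.choose])]
        refine (InternalCategoryData.comp_congr _ (g' := z ≫ q ≫ i)
          (h' := (x ≫ u.obj) ≫ Y.unit) (Category.assoc _ _ _) ?_).trans (Y.comp_unit _ _ ?_)
        · rw [← InternalCategoryData.precomp_comp _ _ _ _ hθ.choose, θ.hom_inv, Category.assoc]
        · simp only [Category.assoc, hx]
      -- Inverses are unique, so a map to `I` is determined by its underlying arrow alone.
      have h₂ := hI.areInverse.precomp (z ≫ q)
      have h₃ := hI.areInverse.precomp (hW.lift x l wl ≫ hP.lift _ _ wκ ≫ q)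
      have e₂ : (hW.lift x l wl ≫ hP.lift _ _ wκ ≫ q) ≫ i = (z ≫ q) ≫ i := by
        simpa only [Category.assoc] using hm
      rw [e₂] at h₃
      rw [Category.assoc]
      exact (hI.existsUnique _ _ h₂).unique ⟨e₂, h₃.unique h₂⟩ ⟨rfl, rfl⟩

end Surjectivity

/-! ### The two implications -/

namespace Diff

/-- By the chain rule; `f` need not be submersive. This is how the comparison map, known only to be
onto, transfers submersivity. -/
theorem isSubmersion_of_surjective_comp {M N K : Diff.{u}} {f : M ⟶ N} {g : N ⟶ K}
    (hf : Function.Surjective f) (h : IsSubmersion (f ≫ g)) : IsSubmersion g :=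
  isSubmersion_iff.2 fun y ↦ by
    obtain ⟨x, rfl⟩ := hf y
    exact (h.submAt x).of_comp

theorem subm_comp {M N K : Diff.{u}} {f : M ⟶ N} {g : N ⟶ K} (hf : Subm f) (hg : Subm g) :
    Subm (f ≫ g) :=
  ⟨isSubmersion_comp hf.1 hg.1, hg.2.comp hf.2⟩

variable {X Y : LieCategory.{u}}
  {f : InternalFunctor X.toInternalCategory Y.toInternalCategory}

theorem essentiallySurjective_of_locallySplit (hf : f.FullyFaithful) (hs : f.LocallySplit Subm) :
    f.EssentiallySurjective Subm := by
  obtain ⟨B, u, -, hu, f', ⟨θ⟩⟩ := hs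
  obtain ⟨U, inv, hU⟩ := exists_isObjectOfIsos _ Y.src_isSubmersion Y.tgt_isSubmersion
  obtain ⟨V, inv', hV⟩ := exists_isObjectOfIsos _ X.src_isSubmersion X.tgt_isSubmersion
  obtain ⟨P, p, q, hP⟩ := exists_isPullback f.obj
    (isSubmersion_comp (isSubmersion_ι U) Y.src_isSubmersion)
  have hVt := isSubmersion_comp (isSubmersion_ι V) X.tgt_isSubmersion
  obtain ⟨W, c, b, hW⟩ := exists_isPullback f'.obj hVt
  obtain ⟨κ, hκ, hκ'⟩ := hf.exists_comparison θ hU hV hP hW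
  have hc : Subm c := by
    refine ⟨isSubmersion_of_isPullback hW hVt, fun x ↦ ?_⟩
    -- Identity arrows at the objects `f' x` give a preimage under `c` of every point.
    obtain ⟨k, ⟨hk, -⟩, -⟩ := hV.existsUnique _ _ (X.areInverse_unit f'.obj)
    obtain ⟨w, hw, -⟩ := exists_point_of_isPullback hW (x := x) (y := k x) (by
      have : k ≫ ι V ≫ X.tgt = f'.obj := by
        rw [reassoc_of% hk, X.unit_tgt, Category.comp_id]
      exact (congr_apply this x).symm)
    exact ⟨w, hw⟩
  have hcu := subm_comp hc hu
  rw [← hκ] at hcu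
  refine ⟨_, ι U, inv, P, p, q, hU, hP, isSubmersion_of_surjective_comp (fun z ↦ ?_) hcu.1,
    Function.Surjective.of_comp (g := κ) hcu.2⟩
  obtain ⟨x, hx⟩ := hu.2 ((q ≫ ι U ≫ Y.tgt) z)
  obtain ⟨w, hw⟩ := hκ' (const z : pt ⟶ P) (const x) (by
    rw [const_comp, const_comp, hx])
  exact ⟨w default, congr_apply hw default⟩

theorem locallySplit_of_essentiallySurjective (hf : f.FullyFaithful)
    (hs : f.EssentiallySurjective Subm) : f.LocallySplit Subm := by
  obtain ⟨I, i, inv, P, p, q, hI, hP, hj⟩ := hs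
  -- The cover is `P` itself; its second component is the isomorphism needed for the factorization.
  let j := q ≫ i ≫ Y.tgt
  obtain ⟨A, a, y, hA⟩ := exists_isPullback j Y.src_isSubmersion
  obtain ⟨B, b, t, hB⟩ := exists_isPullback (y ≫ Y.tgt) hj.1
  have hs' : IsSubmersion (b ≫ a) := isSubmersion_comp (isSubmersion_of_isPullback hB hj.1)
    (isSubmersion_of_isPullback hA Y.src_isSubmersion)
  have H := IsArrowPullback.of_isPullback hA hB
  obtain ⟨Q, r, r', hQ⟩ := exists_isPullback t hs'
  obtain ⟨R, l, l', hR⟩ := exists_isPullback r' (isSubmersion_of_isPullback hQ hs')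
  obtain ⟨e, he⟩ := H.exists_unit
  obtain ⟨m, hm⟩ := H.exists_mul hQ
  refine ⟨_, InternalCategory.baseChangeFunctor _ H hQ hR he hm, H, hj, ?_⟩
  exact hf.exists_factorization _ p (q ≫ i) (q ≫ inv) (hI.areInverse.precomp q)
    ((Category.assoc _ _ _).trans hP.w.symm) (Category.assoc _ _ _)

end Diff

theorem mainTheorem7 (X Y : LieCategory.{u})
    (f : InternalFunctor X.toInternalCategory Y.toInternalCategory) :
    f.IsEquivalence Diff.Subm ↔ f.IsBungePareEquivalence Diff.Subm := by
  exact and_congr_right fun hf ↦ ⟨Diff.essentiallySurjective_of_locallySplit hf,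
    Diff.locallySplit_of_essentiallySurjective hf⟩
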